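/- Let $x=(x^1,\dots,x^p)$ be independent variables, one of which, $t=x^\tau$, is time, and let $u=(u^1,\dots,u^q)$ be dependent variables. Let $U$ be an open subset of the jet space with coordinates $x^i$, $u^a_J$; all identities between differential functions (functions of $x$, $u$ and finitely many derivatives of $u$) are understood on $U$, and summation over repeated indices is assumed. $D_i$ is the $i$-th total derivative, $D_J$ (for a multi-index $J$) its iterates, $(-D)_J=(-1)^{|J|}D_J$, $E_a=(-D)_J\,\partial/\partial u^a_J$ the Euler operator, $X_\alpha=(D_J\alpha^a)\,\partial/\partial u^a_J$. For a $q\times q$ matrix of total differential operators $T^{ab}=T^{abJ}D_J$ (finite sums) put $(T\Delta)^a=T^{abJ}D_J\Delta^b$ and $(T^*\alpha)^b=(-D)_J(T^{abJ}\alpha^a)$. A system $S=(S^1,\dots,S^q)$ is in Cauchy–Kovalevskaya form of orders $n=(n^1,\dots,n^q)$, $n^a\ge 1$, if $S^a=\partial_t^{n^a}u^a-Q^a$, where the $Q^a$ are smooth differential functions which depend only on $x$ and on those derivatives $u^b_J$ that contain fewer than $n^b$ differentiations in $t$. (If all $n^a=1$, these are the evolution systems $u_t-Q[u]$.) A system $S$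 can be brought into this form if $BS$ is in this form for some $q\times q$ matrix $B$ of total differential operators with smooth coefficients on $U$. If $S$ can be brought into Cauchy–Kovalevskaya form of orders $n$, the system $\{\gamma=0,\ S=0\}$, with $\gamma=(\gamma^1,\dots,\gamma^q)$, is called compatible (with respect to these orders) if $\gamma=0$ is preserved by the time evolution of $S=0$, in the following sense. Let $u$ be a real-analytic solution of $S=0$ on a connected open set $\Omega\subset\mathbb R^p$ whose jets lie in $U$, and let $t_0$ be a time with $\Omega\cap\{t=t_0\}\neq\emptyset$. If $(D_t^k\gamma^a)[u]=0$ on $\Omega\cap\{t=t_0\}$ for all $a$ and all $0\le k<n^a$ (for evolution systems: if $\gamma[u]=0$ at $t=t_0$), then $\gamma[u]=0$ on all of $\Omega$. **Proposition (duality of compatible systems).** Let $\Delta=(\Delta^1,\dots,\Delta^q)$ be a system in Cauchy–Kovalevskaya form of orders $n$ (for example an evolution system $\Delta=u_t-P[u]$), $L$ a smooth differential function, $T$ a $q\times q$ matrix of total differential operators with real-analytic coefficients and $\alpha=(\alpha^1,\dots,\alpha^q)$ a tuple of real-analytic differential functions. Suppose that $E(L)=T\Delta$ and that $X_\alpha L$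 is a total divergence, $X_\alpha L=D_iM^i$ with smooth differential functions $M^i$. Then 1. $\{T^*\alpha=0,\ \Delta=0\}$ is a compatible system (with respect to the orders $n$); 2. $\{\alpha=0,\ T\Delta=0\}$ is a compatible system with respect to any orders $m$ for which the system $T\Delta$ can be brought into Cauchy–Kovalevskaya form. -/

import Mathlib

open scoped ContDiff

noncomputable section

namespace JetCalculus

/-- Multi-indices `J`: `J i` is the number of derivatives in the `i`-th independent variable
(so multi-indices are unordered). -/
abbrev MultiIdx (p : ℕ) : Type := Fin p → ℕ

/-- Length of a multi-index. -/
def MultiIdx.len {p : ℕ} (J : MultiIdx p) : ℕ := ∑ i, J i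

/-- Coordinates on the infinite jet space of maps `ℝ^p → ℝ^q`: the independent variables `x^i`
(`Sum.inl i`) and the derivative coordinates `u^a_J` (`Sum.inr (a, J)`). -/
abbrev Coord (p q : ℕ) : Type := Fin p ⊕ (Fin q × MultiIdx p)

/-- The infinite jet space (with the product topology). -/
abbrev Jet (p q : ℕ) : Type := Coord p q → ℝ

/-- The coordinate `x^i`. -/
abbrev xc {p q : ℕ} (i : Fin p) : Coord p q := Sum.inl i

/-- The coordinate `u^a_J`. -/
abbrev uc {p q : ℕ} (a : Fin q) (J : MultiIdx p) : Coord p q := Sum.inr (a, J)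

/-- Partial derivative of a function of a family of real variables in the variable `c`. -/
def pd {κ : Type*} [DecidableEq κ] (c : κ) (f : (κ → ℝ) → ℝ) (z : κ → ℝ) : ℝ :=
  deriv (fun s : ℝ => f (Function.update z c s)) (z c)

/-- `f` is a differential function of class `C^N` on the part `U` of jet space: on `U` it is a
`C^N` function of finitely many of the coordinates (`N = ∞`: smooth, `N = ω`: real analytic). -/
def IsDiffFun {p q : ℕ} (N : WithTop ℕ∞) (U : Set (Jet p q)) (f : Jet p q → ℝ) : Prop :=
  ∃ (s : Finset (Coord p q)) (g : (s → ℝ) → ℝ), ∀ z ∈ U,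
    ContDiffAt ℝ N g (fun c : s => z c) ∧ f z = g (fun c : s => z c)

/-- Apply to `f` the composition of the operators `D i`, each repeated `J i` times. -/
def iterOp {p : ℕ} {F : Type*} (D : Fin p → F → F) (J : MultiIdx p) (f : F) : F :=
  (List.finRange p).foldr (fun i g => (D i)^[J i] g) f

/-- Total derivative `D_i = ∂_{x^i} + ∑_{a,J} u^a_{J,i} ∂_{u^a_J}`. -/
def totalD {p q : ℕ} (i : Fin p) (f : Jet p q → ℝ) (z : Jet p q) : ℝ :=
  pd (xc i) f z +
    ∑ᶠ c : Fin q × MultiIdx p, z (uc c.1 (c.2 + Pi.single i 1)) * pd (uc c.1 c.2) f z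

/-- Iterated total derivative `D_J`. -/
def totalDJ {p q : ℕ} (J : MultiIdx p) (f : Jet p q → ℝ) : Jet p q → ℝ :=
  iterOp totalD J f

/-- Euler operator `E_a = ∑_J (-D)_J ∂/∂u^a_J`. -/
def euler {p q : ℕ} (a : Fin q) (f : Jet p q → ℝ) (z : Jet p q) : ℝ :=
  ∑ᶠ J : MultiIdx p, (-1 : ℝ) ^ J.len * totalDJ J (pd (uc a J) f) z

/-- The evolutionary vector field `X_α = ∑_{a,J} (D_J α^a) ∂/∂u^a_J`. -/
def evol {p q : ℕ} (α : Fin q → Jet p q → ℝ) (f : Jet p q → ℝ) (z : Jet p q) : ℝ :=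
  ∑ᶠ c : Fin q × MultiIdx p, totalDJ c.2 (α c.1) z * pd (uc c.1 c.2) f z

/-- `f` is a total divergence `∑_i D_i M^i` on `U`, with smooth differential functions `M^i`. -/
def IsDivergence {p q : ℕ} (U : Set (Jet p q)) (f : Jet p q → ℝ) : Prop :=
  ∃ M : Fin p → Jet p q → ℝ, (∀ i, IsDiffFun ∞ U (M i)) ∧
    ∀ z ∈ U, f z = ∑ i, totalD i (M i) z

/-- A `q × q` matrix of total differential operators: `T a b J` is the coefficient `T^{abJ}` in
`T^{ab} = ∑_J T^{abJ} D_J` (a finite sum). -/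
abbrev DiffOp (p q : ℕ) : Type := Fin q → Fin q → (MultiIdx p →₀ (Jet p q → ℝ))

/-- All coefficients of `T` are differential functions of class `C^N` on `U`. -/
def DiffOp.IsClass {p q : ℕ} (N : WithTop ℕ∞) (U : Set (Jet p q)) (T : DiffOp p q) : Prop :=
  ∀ a b J, IsDiffFun N U (T a b J)

/-- `(T Δ)^a = ∑_{b,J} T^{abJ} D_J Δ^b`. -/
def DiffOp.app {p q : ℕ} (T : DiffOp p q) (Δ : Fin q → Jet p q → ℝ) (a : Fin q)
    (z : Jet p q) : ℝ :=
  ∑ b, (T a b).sum fun J c => c z * totalDJ J (Δ b) z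

/-- The formal adjoint applied to `α`: `(T* α)^b = ∑_{a,J} (-D)_J (T^{abJ} α^a)`. -/
def DiffOp.adj {p q : ℕ} (T : DiffOp p q) (α : Fin q → Jet p q → ℝ) (b : Fin q)
    (z : Jet p q) : ℝ :=
  ∑ a, (T a b).sum fun J c => (-1 : ℝ) ^ J.len * totalDJ J (fun w => c w * α a w) z

/-- The infinite jet of a map `u : ℝ^p → ℝ^q` at the point `y`: the values of the coordinates
`x^i = y^i`, `u^a_J = ∂_J u^a (y)`. -/
def jet {p q : ℕ} (u : (Fin p → ℝ) → (Fin q → ℝ)) (y : Fin p → ℝ) : Jet p q :=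
  Sum.elim y fun c => iterOp pd c.2 (fun w => u w c.1) y

/-- The system `Δ = 0` is in Cauchy–Kovalevskaya form with respect to the time variable
`t = x^τ`, of orders `n^a ≥ 1`: `Δ^a = ∂_t^{n^a} u^a - Q^a`, where each `Q^a` depends only on the
`x^i` and on those `u^b_J` which contain fewer than `n^b` differentiations in `t`.
If `n^a = 1` for all `a`, these are the evolution systems `Δ = u_t - Q[u]`. -/
def IsCKForm {p q : ℕ} (U : Set (Jet p q)) (τ : Fin p) (n : Fin q → ℕ)
    (Δ : Fin q → Jet p q → ℝ) : Prop :=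
  (∀ a, 1 ≤ n a) ∧ ∃ Q : Fin q → Jet p q → ℝ,
    (∀ a, IsDiffFun ∞ U (Q a)) ∧
    (∀ a b J, n b ≤ J τ → ∀ z ∈ U, pd (uc b J) (Q a) z = 0) ∧
    ∀ a, ∀ z ∈ U, Δ a z = z (uc a (Pi.single τ (n a))) - Q a z

/-- The system `S = 0` can be brought into Cauchy–Kovalevskaya form of orders `n`: some
combination `B S` of the equations and their total derivatives, with smooth coefficients, is in
that form. -/
def HasCKForm {p q : ℕ} (U : Set (Jet p q)) (τ : Fin p) (n : Fin q → ℕ)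
    (S : Fin q → Jet p q → ℝ) : Prop :=
  ∃ B : DiffOp p q, B.IsClass ∞ U ∧ IsCKForm U τ n (B.app S)

/-- The system `{γ = 0, S = 0}` is compatible: the condition `γ = 0` is preserved by the time
evolution of `S = 0`, a system which can be brought into Cauchy–Kovalevskaya form of orders `n`.
Here `u` is an analytic solution of `S = 0` on a connected space-time domain `Ω` and `t₀` is an
initial time. Once such a system is rewritten as an evolution system for the `∂_t^k u^a`,
`k < n^a`, the condition on the initial data is that of all `D_t^k γ^a`, `k < n^a`; for
`n^a = 1` it is just `γ^a = 0` at time `t₀`. -/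
def IsCompatible {p q : ℕ} (U : Set (Jet p q)) (τ : Fin p) (n : Fin q → ℕ)
    (S γ : Fin q → Jet p q → ℝ) : Prop :=
  ∀ (Ω : Set (Fin p → ℝ)) (u : (Fin p → ℝ) → (Fin q → ℝ)) (t₀ : ℝ),
    IsOpen Ω → IsPreconnected Ω → (∃ y ∈ Ω, y τ = t₀) →
    AnalyticOnNhd ℝ u Ω → (∀ y ∈ Ω, jet u y ∈ U) →
    (∀ y ∈ Ω, ∀ a, S a (jet u y) = 0) →
    (∀ y ∈ Ω, y τ = t₀ → ∀ a, ∀ k < n a, ((totalD τ)^[k] (γ a)) (jet u y) = 0) →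
    ∀ y ∈ Ω, ∀ a, γ a (jet u y) = 0

end JetCalculus

end

open scoped ContDiff

/-! Let `u` be a solution with `E(L) = 0` along it; this holds for solutions of `Δ = 0` and of `T Δ
= 0`, because `E(L) = T Δ`. Write `lin u w f` for the derivative of `f` along the jets of `u + ε w`
at `ε = 0`.

Linearize `X_α L = D_i M^i` at `u` in the direction of a test function `w` and integrate. The
divergence disappears. In the product rule for `X_α L`, integration by parts turns the terms with
`lin α` into `E_a(L) lin α^a`, which is zero, and the others into `α^a lin E_a(L)`. So `α[u]` is
orthogonal to the image of the linearized Euler–Lagrange operator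
(`integral_mul_lin_euler_eq_zero`). That operator is formally self-adjoint, since second partial
derivatives of `L` commute; hence `α[u]` also lies in its kernel (`lin_euler_symmetry_eq_zero`).

For the second claim, the kernel statement says that `α[u]` solves the linearization of `T Δ`. Since
`T Δ = 0` along `u`, it also solves the linearization of `B T Δ`, a linear Cauchy–Kovalevskaya
system. For the first claim, `Δ = 0` along `u` makes the linearization of `T Δ` equal to `T` applied
to that of `Δ`, so orthogonality moves over to `T* α` and says that `T* α` solves the adjoint of the
linearized system `Δ` (`integral_adj_mul_lin`). This adjoint can again be solved for the highest
time derivatives.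

In both cases zero Cauchy data force all time derivatives to vanish on the initial slice
(`vanishesOnSlice_of_lin_eq_zero`, `vanishesOnSlice_of_adjoint_eq_zero`), and analyticity on a
connected domain does the rest (`eqOn_zero_of_vanishesOnSlice`). No existence theorem for the Cauchy
problem is used. -/

namespace JetCalculus

open Filter Topology MeasureTheory

/-! ### Iterated operators and multi-indices. -/

section IterOp

variable {p : ℕ}

/-- A relation preserved by the operators `D i`, `D' i` is preserved by `iterOp`. -/
theorem iterOp_rel {F G : Type*} {D : Fin p → F → F} {D' : Fin p → G → G} (R : F → G → Prop)
    (h : ∀ i f g, R f g → R (D i f) (D' i g)) (J : MultiIdx p) {f : F} {g : G} (hfg : R f g) :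
    R (iterOp D J f) (iterOp D' J g) := by
  unfold iterOp
  induction List.finRange p with
  | nil => exact hfg
  | cons i l ih =>
    simp only [List.foldr_cons]
    induction J i with
    | zero => exact ih
    | succ k ihk =>
      rw [Function.iterate_succ_apply', Function.iterate_succ_apply']
      exact h _ _ _ ihk

theorem iterOp_pred {F : Type*} {D : Fin p → F → F} (P : F → Prop)
    (h : ∀ i f, P f → P (D i f)) (J : MultiIdx p) {f : F} (hf : P f) : P (iterOp D J f) :=
  iterOp_rel (D' := D) (fun f _ => P f) (fun i f _ => h i f) J (g := f) hf

@[simp] theorem iterOp_zero {F : Type*} (D : Fin p → F → F) (f : F) : iterOp D 0 f = f := by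
  unfold iterOp
  induction List.finRange p with
  | nil => rfl
  | cons i l ih => simp

/-- If the operators `D i` commute up to an equivalence relation, then `D i` after `iterOp D J`
is `iterOp D (J + e_i)` up to that relation. -/
theorem iterOp_add_single {F : Type*} {D : Fin p → F → F} (P : F → Prop) (R : F → F → Prop)
    (hR : Equivalence R) (hP : ∀ i f, P f → P (D i f)) (hD : ∀ i f g, R f g → R (D i f) (D i g))
    (hc : ∀ i j f, P f → R (D i (D j f)) (D j (D i f))) (J : MultiIdx p) (i : Fin p) {f : F}
    (hf : P f) : R (D i (iterOp D J f)) (iterOp D (J + Pi.single i 1) f) := by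
  have hit : ∀ (j : Fin p) (k : ℕ) (g : F), P g → R (D i ((D j)^[k] g)) ((D j)^[k] (D i g)) := by
    intro j k g hg
    induction k generalizing g with
    | zero => exact hR.refl _
    | succ k ih =>
      rw [Function.iterate_succ_apply, Function.iterate_succ_apply]
      refine hR.trans (ih _ (hP _ _ hg)) ?_
      clear ih
      induction k with
      | zero => exact hc _ _ _ hg
      | succ k ih =>
        rw [Function.iterate_succ_apply', Function.iterate_succ_apply']
        exact hD _ _ _ ih
  have hitR : ∀ (j : Fin p) (k : ℕ) (g g' : F), R g g' → R ((D j)^[k] g) ((D j)^[k] g') := by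
    intro j k g g' hg
    induction k with
    | zero => exact hg
    | succ k ih =>
      rw [Function.iterate_succ_apply', Function.iterate_succ_apply']
      exact hD _ _ _ ih
  have hPf : ∀ l : List (Fin p), P (l.foldr (fun i g => (D i)^[J i] g) f) := by
    intro l
    induction l with
    | nil => exact hf
    | cons j l ih =>
      simp only [List.foldr_cons]
      induction J j with
      | zero => exact ih
      | succ k ihk => rw [Function.iterate_succ_apply']; exact hP _ _ ihk
  have key : ∀ l : List (Fin p), l.Nodup → i ∈ l →
      R (D i (l.foldr (fun i g => (D i)^[J i] g) f))
        (l.foldr (fun j g => (D j)^[(J + Pi.single i 1 : MultiIdx p) j] g) f) := by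
    intro l
    induction l with
    | nil => intro _ h; simp at h
    | cons j l ih =>
      intro hn hm
      simp only [List.foldr_cons]
      by_cases hij : i = j
      · subst hij
        have hni : i ∉ l := (List.nodup_cons.1 hn).1
        have : l.foldr (fun j g => (D j)^[(J + Pi.single i 1 : MultiIdx p) j] g) f =
            l.foldr (fun j g => (D j)^[J j] g) f := by
          refine List.foldr_ext _ _ _ fun a ha b => ?_
          have : a ≠ i := fun h => hni (h ▸ ha)
          simp [this]
        rw [this]
        simp only [Pi.add_apply, Pi.single_eq_same]
        rw [Function.iterate_succ_apply']
        exact hR.refl _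
      · have hm' : i ∈ l := (List.mem_cons.1 hm).resolve_left hij
        have e : (J + Pi.single i 1 : MultiIdx p) j = J j := by
          simp [Pi.single_eq_of_ne (Ne.symm hij)]
        rw [e]
        exact hR.trans (hit j (J j) _ (hPf l)) (hitR _ _ _ _ (ih (List.nodup_cons.1 hn).2 hm'))
  exact key _ (List.nodup_finRange p) (List.mem_finRange i)

theorem iterOp_single {F : Type*} (D : Fin p → F → F) (i : Fin p) (k : ℕ) (f : F) :
    iterOp D (Pi.single i k) f = (D i)^[k] f := by
  unfold iterOp
  have key : ∀ l : List (Fin p), l.Nodup →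
      l.foldr (fun j g => (D j)^[(Pi.single i k : MultiIdx p) j] g) f =
        if i ∈ l then (D i)^[k] f else f := by
    intro l
    induction l with
    | nil => simp
    | cons j l ih =>
      intro hn
      obtain ⟨h1, h2⟩ := List.nodup_cons.1 hn
      rw [List.foldr_cons, ih h2]
      by_cases hij : i = j
      · subst hij; simp [h1]
      · simp [hij]
  rw [key _ (List.nodup_finRange p)]
  simp

/-- Lowering a positive entry shortens a multi-index, so `D_J` can be treated one derivative at a
time. -/
theorem MultiIdx.induction {P : MultiIdx p → Prop} (h0 : P 0)
    (h1 : ∀ J i, P J → P (J + Pi.single i 1)) (J : MultiIdx p) : P J := by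
  obtain ⟨k, hk⟩ : ∃ k, J.len = k := ⟨_, rfl⟩
  induction k generalizing J with
  | zero =>
    have : J = 0 := by
      funext i
      exact Finset.sum_eq_zero_iff.1 hk i (Finset.mem_univ i)
    rw [this]; exact h0
  | succ k ih =>
    have : ∃ i, J i ≠ 0 := by
      by_contra! h
      have : J.len = 0 := Finset.sum_eq_zero fun i _ => h i
      omega
    obtain ⟨i, hi⟩ := this
    have e : J = Function.update J i (J i - 1) + Pi.single i 1 := by
      funext j
      by_cases hj : j = i
      · subst hj; simp; omega
      · simp [hj]
    rw [e]
    apply h1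
    apply ih
    have h2 : J.len = MultiIdx.len (Function.update J i (J i - 1)) + 1 := by
      conv_lhs => rw [e]
      simp [MultiIdx.len, Finset.sum_add_distrib]
    omega

theorem MultiIdx.len_add_single (J : MultiIdx p) (i : Fin p) :
    MultiIdx.len (J + Pi.single i 1) = J.len + 1 := by
  simp [MultiIdx.len, Finset.sum_add_distrib]

end IterOp

/-! ### Coordinate partial derivatives and their relation to the Fréchet derivative. -/

section PartialDerivatives

variable {κ : Type*} [DecidableEq κ]

theorem tendsto_update {κ : Type*} [DecidableEq κ] (z : κ → ℝ) (c : κ) :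
    Tendsto (fun s : ℝ => Function.update z c s) (𝓝 (z c)) (𝓝 z) := by
  have h := (continuous_const (y := z)).update c (continuous_id (X := ℝ)) |>.tendsto (z c)
  simpa using h

/-- No finiteness of `κ` is assumed: the lemma must also serve the infinite jet space, which has a
topology but no norm. -/
theorem pd_congr_of_eventuallyEq {f g : (κ → ℝ) → ℝ} {z : κ → ℝ} (h : f =ᶠ[𝓝 z] g) (c : κ) :
    pd c f z = pd c g z := by
  exact EventuallyEq.deriv_eq ((tendsto_update z c).eventually h)

theorem pd_congr {Ω : Set (κ → ℝ)} (hΩ : IsOpen Ω) {f g : (κ → ℝ) → ℝ} (h : Set.EqOn f g Ω)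
    (c : κ) : Set.EqOn (pd c f) (pd c g) Ω := fun _ hz =>
  pd_congr_of_eventuallyEq (h.eventuallyEq_of_mem (hΩ.mem_nhds hz)) c

@[simp] theorem pd_zero (c : κ) : pd c (fun _ : κ → ℝ => (0 : ℝ)) = fun _ => 0 := by
  funext z; simp [pd]

variable [Fintype κ]

theorem hasDerivAt_pd {f : (κ → ℝ) → ℝ} {z : κ → ℝ} (hf : DifferentiableAt ℝ f z) (c : κ) :
    HasDerivAt (fun s : ℝ => f (Function.update z c s)) (fderiv ℝ f z (Pi.single c 1)) (z c) := by
  have h1 := hasDerivAt_update z c (z c)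
  have h2 : HasFDerivAt f (fderiv ℝ f z) (Function.update z c (z c)) := by
    simpa using hf.hasFDerivAt
  exact h2.comp_hasDerivAt _ h1

theorem pd_eq_fderiv {f : (κ → ℝ) → ℝ} {z : κ → ℝ} (hf : DifferentiableAt ℝ f z) (c : κ) :
    pd c f z = fderiv ℝ f z (Pi.single c 1) := (hasDerivAt_pd hf c).deriv

theorem pd_eventuallyEq {f : (κ → ℝ) → ℝ} {z : κ → ℝ} {N : WithTop ℕ∞} (hN : 1 ≤ N)
    (hf : ContDiffAt ℝ N f z) (c : κ) :
    pd c f =ᶠ[𝓝 z] fun w => fderiv ℝ f w (Pi.single c 1) := by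
  filter_upwards [(hf.of_le hN).eventually (by simp)] with w hw
  exact pd_eq_fderiv (hw.differentiableAt (by simp)) c

theorem contDiffAt_pd {f : (κ → ℝ) → ℝ} {z : κ → ℝ} {M N : WithTop ℕ∞} (hN : M + 1 ≤ N)
    (hf : ContDiffAt ℝ N f z) (c : κ) : ContDiffAt ℝ M (pd c f) z :=
  ((hf.fderiv_right hN).clm_apply contDiffAt_const).congr_of_eventuallyEq
    (pd_eventuallyEq (le_trans (by simp) hN) hf c)

theorem fderiv_fderiv_apply_comm {E : Type*} [NormedAddCommGroup E] [NormedSpace ℝ E]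
    {f : E → ℝ} {z : E} (hf : ContDiffAt ℝ 2 f z) (v w : E) :
    fderiv ℝ (fun x => fderiv ℝ f x v) z w = fderiv ℝ (fun x => fderiv ℝ f x w) z v := by
  have hd : DifferentiableAt ℝ (fderiv ℝ f) z :=
    (hf.fderiv_right (m := 1) (by norm_num)).differentiableAt (by simp)
  rw [fderiv_clm_apply hd (differentiableAt_const _), fderiv_clm_apply hd (differentiableAt_const _)]
  simpa using (hf.isSymmSndFDerivAt (by simp)).eq w v

theorem pd_comm {f : (κ → ℝ) → ℝ} {z : κ → ℝ} (hf : ContDiffAt ℝ 2 f z) (c d : κ) :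
    pd c (pd d f) z = pd d (pd c f) z := by
  have key : ∀ c d, pd c (pd d f) z =
      fderiv ℝ (fun x => fderiv ℝ f x (Pi.single d 1)) z (Pi.single c 1) := by
    intro c d
    have hd : ContDiffAt ℝ 1 (pd d f) z := contDiffAt_pd (by norm_num) hf d
    rw [pd_eq_fderiv (hd.differentiableAt (by simp)),
      (pd_eventuallyEq (by norm_num) hf d).fderiv_eq]
  rw [key, key, fderiv_fderiv_apply_comm hf]

/-- `f` is of class `C^N` at each point of `Ω`. -/
def IsCkOn {E : Type*} [NormedAddCommGroup E] [NormedSpace ℝ E] (N : WithTop ℕ∞) (Ω : Set E)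
    (f : E → ℝ) : Prop := ∀ y ∈ Ω, ContDiffAt ℝ N f y

namespace IsCkOn

variable {E : Type*} [NormedAddCommGroup E] [NormedSpace ℝ E] {N : WithTop ℕ∞} {Ω : Set E}
  {f g : E → ℝ}

theorem add (hf : IsCkOn N Ω f) (hg : IsCkOn N Ω g) : IsCkOn N Ω (fun y => f y + g y) :=
  fun y hy => (hf y hy).add (hg y hy)

theorem mul (hf : IsCkOn N Ω f) (hg : IsCkOn N Ω g) : IsCkOn N Ω (fun y => f y * g y) :=
  fun y hy => (hf y hy).mul (hg y hy)

theorem const (c : ℝ) : IsCkOn N Ω (fun _ => c) := fun _ _ => contDiffAt_const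

theorem sum {ι : Type*} {s : Finset ι} {f : ι → E → ℝ} (h : ∀ i ∈ s, IsCkOn N Ω (f i)) :
    IsCkOn N Ω (fun y => ∑ i ∈ s, f i y) :=
  fun y hy => ContDiffAt.sum fun i hi => h i hi y hy

theorem congr (hΩ : IsOpen Ω) (hf : IsCkOn N Ω f) (h : Set.EqOn g f Ω) : IsCkOn N Ω g :=
  fun y hy => (hf y hy).congr_of_eventuallyEq (h.eventuallyEq_of_mem (hΩ.mem_nhds hy))

theorem of_le {M : WithTop ℕ∞} (hf : IsCkOn N Ω f) (h : M ≤ N) : IsCkOn M Ω f :=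
  fun y hy => (hf y hy).of_le h

theorem differentiableAt (hf : IsCkOn N Ω f) (hN : 1 ≤ N) {y : E} (hy : y ∈ Ω) :
    DifferentiableAt ℝ f y :=
  (hf y hy).differentiableAt (by rintro rfl; simp at hN)

end IsCkOn

variable {Ω : Set (κ → ℝ)} {f g : (κ → ℝ) → ℝ}

/-- The condition `N + 1 ≤ N` singles out `∞` and `ω`, so the smooth and analytic cases share one
proof. -/
theorem IsCkOn.pd {N : WithTop ℕ∞} (hN : N + 1 ≤ N) (hf : IsCkOn N Ω f) (c : κ) :
    IsCkOn N Ω (pd c f) := fun y hy => contDiffAt_pd hN (hf y hy) c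

theorem pd_add {z : κ → ℝ} (hf : DifferentiableAt ℝ f z) (hg : DifferentiableAt ℝ g z) (c : κ) :
    pd c (fun y => f y + g y) z = pd c f z + pd c g z := by
  rw [pd_eq_fderiv (hf.fun_add hg), pd_eq_fderiv hf, pd_eq_fderiv hg, fderiv_fun_add hf hg]; rfl

theorem pd_mul {z : κ → ℝ} (hf : DifferentiableAt ℝ f z) (hg : DifferentiableAt ℝ g z) (c : κ) :
    pd c (fun y => f y * g y) z = pd c f z * g z + f z * pd c g z := by
  rw [pd_eq_fderiv (hf.fun_mul hg), pd_eq_fderiv hf, pd_eq_fderiv hg, fderiv_fun_mul hf hg]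
  simp only [add_apply, smul_apply, smul_eq_mul]; ring

end PartialDerivatives

/-! ### Iterated partial derivatives on an open set. -/

section IterPd

variable {p : ℕ} {Ω : Set (Fin p → ℝ)} {f g : (Fin p → ℝ) → ℝ}

theorem iterPd_congr (hΩ : IsOpen Ω) (h : Set.EqOn f g Ω) (J : MultiIdx p) :
    Set.EqOn (iterOp pd J f) (iterOp pd J g) Ω :=
  iterOp_rel (fun f g => Set.EqOn f g Ω) (fun i _ _ h => pd_congr hΩ h i) J h

theorem IsCkOn.iterPd {N : WithTop ℕ∞} (hN : N + 1 ≤ N) (hf : IsCkOn N Ω f) (J : MultiIdx p) :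
    IsCkOn N Ω (iterOp JetCalculus.pd J f) :=
  iterOp_pred (IsCkOn N Ω) (fun i _ h => h.pd hN i) J hf

theorem pd_iterPd (hΩ : IsOpen Ω) (hf : IsCkOn ∞ Ω f) (J : MultiIdx p) (i : Fin p) :
    Set.EqOn (pd i (iterOp pd J f)) (iterOp pd (J + Pi.single i 1) f) Ω :=
  iterOp_add_single (IsCkOn ∞ Ω) (fun f g => Set.EqOn f g Ω)
    ⟨fun _ => Set.eqOn_refl _ _, fun h => h.symm, fun h h' => h.trans h'⟩
    (fun i _ h => h.pd (by simp) i) (fun i _ _ h => pd_congr hΩ h i)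
    (fun i j _ h y hy => pd_comm ((h y hy).of_le (WithTop.coe_le_coe.2 le_top)) i j) J i hf

theorem iterPd_pd (hΩ : IsOpen Ω) (hf : IsCkOn ∞ Ω f) (J : MultiIdx p) (i : Fin p) :
    Set.EqOn (iterOp pd J (pd i f)) (pd i (iterOp pd J f)) Ω :=
  (iterOp_rel (fun f g => IsCkOn ∞ Ω f ∧ Set.EqOn g (pd i f) Ω)
    (fun j f _ h => ⟨h.1.pd (by simp) j, (pd_congr hΩ h.2 j).trans fun y hy =>
      pd_comm ((h.1 y hy).of_le (WithTop.coe_le_coe.2 le_top)) j i⟩) J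
    ⟨hf, Set.eqOn_refl _ _⟩).2

theorem iterPd_zero_fun (J : MultiIdx p) :
    iterOp pd J (fun _ : Fin p → ℝ => (0 : ℝ)) = fun _ => 0 :=
  iterOp_pred (fun f => f = fun _ : Fin p → ℝ => (0 : ℝ)) (fun i f h => by rw [h, pd_zero]) J rfl

end IterPd

/-! ### Differential functions and total derivatives. -/

section DiffFun

variable {p q : ℕ} {N : WithTop ℕ∞} {U : Set (Jet p q)} {f g : Jet p q → ℝ}

theorem IsDiffFun.congr (hf : IsDiffFun N U f) (h : Set.EqOn g f U) : IsDiffFun N U g := by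
  obtain ⟨s, G, hG⟩ := hf
  exact ⟨s, G, fun z hz => ⟨(hG z hz).1, (h hz).trans (hG z hz).2⟩⟩

theorem IsDiffFun.of_le {M : WithTop ℕ∞} (hf : IsDiffFun N U f) (h : M ≤ N) : IsDiffFun M U f := by
  obtain ⟨s, G, hG⟩ := hf
  exact ⟨s, G, fun z hz => ⟨(hG z hz).1.of_le h, (hG z hz).2⟩⟩

theorem IsDiffFun.enlarge {s s' : Finset (Coord p q)} (hs : s ⊆ s') {G : (s → ℝ) → ℝ}
    (hG : ∀ z ∈ U, ContDiffAt ℝ N G (fun c : s => z c) ∧ f z = G (fun c : s => z c)) :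
    ∃ G' : (s' → ℝ) → ℝ, ∀ z ∈ U,
      ContDiffAt ℝ N G' (fun c : s' => z c) ∧ f z = G' (fun c : s' => z c) := by
  refine ⟨fun x => G fun c => x ⟨c, hs c.2⟩, fun z hz => ⟨?_, (hG z hz).2⟩⟩
  have h : ContDiffAt ℝ N (fun (x : s' → ℝ) (c : s) => x ⟨c, hs c.2⟩) (fun c : s' => z c) := by
    fun_prop
  exact ContDiffAt.comp (g := G) (fun c : s' => z c) (hG z hz).1 h

theorem IsDiffFun.map₂ {φ : ℝ → ℝ → ℝ} (hφ : ContDiff ℝ N fun x : ℝ × ℝ => φ x.1 x.2)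
    (hf : IsDiffFun N U f) (hg : IsDiffFun N U g) : IsDiffFun N U fun z => φ (f z) (g z) := by
  obtain ⟨s, F, hF⟩ := hf
  obtain ⟨t, G, hG⟩ := hg
  obtain ⟨F', hF'⟩ := IsDiffFun.enlarge (Finset.subset_union_left (s₂ := t)) hF
  obtain ⟨G', hG'⟩ := IsDiffFun.enlarge (Finset.subset_union_right (s₁ := s)) hG
  refine ⟨s ∪ t, fun x => φ (F' x) (G' x), fun z hz => ⟨?_, ?_⟩⟩
  · exact hφ.contDiffAt.comp (g := fun x : ℝ × ℝ => φ x.1 x.2) _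
      ((hF' z hz).1.prodMk (hG' z hz).1)
  · simp only [(hF' z hz).2, (hG' z hz).2]

theorem IsDiffFun.add (hf : IsDiffFun N U f) (hg : IsDiffFun N U g) :
    IsDiffFun N U fun z => f z + g z := hf.map₂ (φ := fun a b => a + b) (by fun_prop) hg

theorem IsDiffFun.sub (hf : IsDiffFun N U f) (hg : IsDiffFun N U g) :
    IsDiffFun N U fun z => f z - g z := hf.map₂ (φ := fun a b => a - b) (by fun_prop) hg

theorem IsDiffFun.mul (hf : IsDiffFun N U f) (hg : IsDiffFun N U g) :
    IsDiffFun N U fun z => f z * g z := hf.map₂ (φ := fun a b => a * b) (by fun_prop) hg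

theorem IsDiffFun.const (r : ℝ) : IsDiffFun N U fun _ => r :=
  ⟨∅, fun _ => r, fun _ _ => ⟨contDiffAt_const, rfl⟩⟩

theorem IsDiffFun.coord (c : Coord p q) : IsDiffFun N U fun z => z c :=
  ⟨{c}, fun x => x ⟨c, by simp⟩, fun _ _ => ⟨by fun_prop, rfl⟩⟩

theorem IsDiffFun.sum {ι : Type*} {s : Finset ι} {f : ι → Jet p q → ℝ}
    (h : ∀ i ∈ s, IsDiffFun N U (f i)) : IsDiffFun N U fun z => ∑ i ∈ s, f i z := by
  classical
  induction s using Finset.induction_on with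
  | empty => simpa using IsDiffFun.const 0
  | insert i s hi ih =>
    simp only [Finset.sum_insert hi]
    exact (h i (by simp)).add (ih fun j hj => h j (by simp [hj]))

theorem pd_eq_zero_of_const {κ : Type*} [DecidableEq κ] {f : (κ → ℝ) → ℝ} {c : κ}
    {z : κ → ℝ} (h : ∀ᶠ s in 𝓝 (z c), f (Function.update z c s) = f z) : pd c f z = 0 := by
  have : (fun s => f (Function.update z c s)) =ᶠ[𝓝 (z c)] fun _ => f z := h
  rw [pd, this.deriv_eq]; simp

/-- Moving one coordinate of a jet moves the same coordinate of its restriction to `s`; this carries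
calculus on jet space back to finitely many variables. -/
theorem pd_restrict (hU : IsOpen U) {s : Finset (Coord p q)} {G : (s → ℝ) → ℝ}
    (hG : ∀ z ∈ U, f z = G (fun c : s => z c)) (c : s) {z : Jet p q} (hz : z ∈ U) :
    pd c.1 f z = pd c G (fun c : s => z c) := by
  refine EventuallyEq.deriv_eq ?_
  filter_upwards [(tendsto_update z c.1).eventually (hU.mem_nhds hz)] with r hr
  rw [hG _ hr]
  congr 1
  funext d
  by_cases hd : d = c
  · subst hd; simp
  · rw [Function.update_of_ne hd, Function.update_of_ne (fun h => hd (Subtype.ext h))]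

/-- A differential function satisfies the chain rule along curves in jet space, and its partial
derivatives are differential functions that vanish off a finite set of coordinates. -/
theorem IsDiffFun.exists_support (hU : IsOpen U) (hN : N + 1 ≤ N) (hf : IsDiffFun N U f) :
    ∃ s : Finset (Coord p q), (∀ c, IsDiffFun N U (pd c f)) ∧
      (∀ c ∉ s, ∀ z ∈ U, pd c f z = 0) ∧
      ∀ (γ : ℝ → Jet p q) (γ' : Jet p q) (t : ℝ), γ t ∈ U →
        (∀ c, HasDerivAt (fun r => γ r c) (γ' c) t) →
          HasDerivAt (fun r => f (γ r)) (∑ c ∈ s, γ' c * pd c f (γ t)) t := by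
  have h1 : 1 ≤ N := le_trans (by simp) hN
  obtain ⟨s, G, hG⟩ := hf
  have hdG : ∀ z ∈ U, DifferentiableAt ℝ G (fun c : s => z c) := fun z hz =>
    (hG z hz).1.differentiableAt (by rintro rfl; simp at h1)
  have hupd : ∀ z ∈ U, ∀ c, ∀ᶠ r in 𝓝 (z c), Function.update z c r ∈ U := fun z hz c =>
    (tendsto_update z c).eventually (hU.mem_nhds hz)
  have hpd0 : ∀ c ∉ s, ∀ z ∈ U, pd c f z = 0 := by
    intro c hc z hz
    refine pd_eq_zero_of_const ?_
    filter_upwards [hupd z hz c] with r hr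
    rw [(hG _ hr).2, (hG _ hz).2]
    congr 1
    funext d
    exact Function.update_of_ne (by rintro rfl; exact hc d.2) _ _
  have hpd : ∀ c : s, ∀ z ∈ U, pd c.1 f z = pd c G (fun c : s => z c) := fun c z hz =>
    pd_restrict hU (fun z hz => (hG z hz).2) c hz
  refine ⟨s, fun c => ?_, hpd0, fun γ γ' t ht hγ => ?_⟩
  · by_cases hc : c ∈ s
    · exact ⟨s, pd ⟨c, hc⟩ G, fun z hz => ⟨contDiffAt_pd hN (hG z hz).1 _, hpd ⟨c, hc⟩ z hz⟩⟩
    · exact (IsDiffFun.const 0).congr fun z hz => hpd0 c hc z hz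
  · have hcont : ContinuousAt γ t := tendsto_pi_nhds.2 fun c => (hγ c).continuousAt
    have hev : (fun r => f (γ r)) =ᶠ[𝓝 t] fun r => G (fun c : s => γ r c) := by
      filter_upwards [hcont.eventually (hU.mem_nhds ht)] with r hr
      exact (hG _ hr).2
    refine HasDerivAt.congr_of_eventuallyEq ?_ hev
    have hγs : HasDerivAt (fun r (c : s) => γ r c) (fun c : s => γ' c) t :=
      hasDerivAt_pi.2 fun c => hγ c
    have h := (hdG _ ht).hasFDerivAt.comp_hasDerivAt t hγs
    have e : fderiv ℝ G (fun c : s => γ t c) (fun c : s => γ' c) =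
        ∑ c ∈ s, γ' c * pd c f (γ t) := by
      have : (fun c : s => γ' c) = ∑ c : s, γ' c • (Pi.single c 1 : s → ℝ) := by
        funext d
        simp [Finset.sum_apply, Pi.single_apply]
      rw [this, map_sum, ← Finset.sum_coe_sort s]
      refine Finset.sum_congr rfl fun c _ => ?_
      rw [map_smul, smul_eq_mul, hpd c _ ht, pd_eq_fderiv (hdG _ ht)]
    rw [e] at h
    exact h

theorem IsDiffFun.pd (hU : IsOpen U) (hN : N + 1 ≤ N) (hf : IsDiffFun N U f) (c : Coord p q) :
    IsDiffFun N U (pd c f) := by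
  obtain ⟨s, h, -⟩ := hf.exists_support hU hN
  exact h c

/-- Partial derivatives of a differential function commute. -/
theorem IsDiffFun.pd_comm (hU : IsOpen U) (hf : IsDiffFun ∞ U f) (c d : Coord p q) :
    Set.EqOn (JetCalculus.pd c (JetCalculus.pd d f)) (JetCalculus.pd d (JetCalculus.pd c f)) U := by
  classical
  obtain ⟨s, G, hG⟩ := hf
  -- Adjoining `c` and `d` makes both of them variables of the finite-dimensional representative.
  obtain ⟨G', hG'⟩ := IsDiffFun.enlarge (Finset.subset_union_left (s₂ := {c, d})) hG
  generalize hs' : s ∪ {c, d} = s' at G' hG'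
  have hc : c ∈ s' := by simp [← hs']
  have hd : d ∈ s' := by simp [← hs']
  intro z hz
  have key : ∀ c : s', ∀ z ∈ U, JetCalculus.pd c.1 f z = JetCalculus.pd c G' (fun c : s' => z c) :=
    fun c z hz => pd_restrict hU (fun z hz => (hG' z hz).2) c hz
  have h1 := pd_restrict hU (key ⟨d, hd⟩) ⟨c, hc⟩ hz
  have h2 := pd_restrict hU (key ⟨c, hc⟩) ⟨d, hd⟩ hz
  rw [h1, h2]
  exact JetCalculus.pd_comm ((hG' z hz).1.of_le (WithTop.coe_le_coe.2 le_top)) _ _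

/-- The derivative of the coordinates along a holonomic section in the direction `x^i`. -/
def shiftCoord (i : Fin p) (z : Jet p q) : Jet p q :=
  Sum.elim (Pi.single i 1) fun c => z (uc c.1 (c.2 + Pi.single i 1))

theorem sum_sumElim {s : Finset (Coord p q)} {F : Coord p q → ℝ} (h : ∀ c ∉ s, F c = 0) :
    ∑ c ∈ s, F c = ∑ j : Fin p, F (Sum.inl j) + ∑ᶠ c : Fin q × MultiIdx p, F (Sum.inr c) := by
  classical
  rw [finsum_eq_sum_of_support_subset (s := s.toRight)]
  · have : ∑ j : Fin p, F (Sum.inl j) = ∑ j ∈ s.toLeft, F (Sum.inl j) := by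
      symm
      refine Finset.sum_subset (Finset.subset_univ _) fun j _ hj => h _ ?_
      simpa using hj
    rw [this, ← Finset.sum_disjSum, Finset.toLeft_disjSum_toRight]
  · intro c hc
    by_contra hcs
    exact hc (h _ (by simpa using hcs))

/-- This form of `D_i`, a derivative along the vector `shiftCoord i z`, is the one the chain rule
produces. -/
theorem totalD_eq_sum {s : Finset (Coord p q)} {z : Jet p q} (h : ∀ c ∉ s, pd c f z = 0)
    (i : Fin p) : totalD i f z = ∑ c ∈ s, shiftCoord i z c * pd c f z := by
  rw [sum_sumElim (F := fun c => shiftCoord i z c * pd c f z) fun c hc => by simp [h c hc]]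
  simp [totalD, shiftCoord, Pi.single_apply]

theorem IsDiffFun.totalD (hU : IsOpen U) (hN : N + 1 ≤ N) (hf : IsDiffFun N U f) (i : Fin p) :
    IsDiffFun N U (totalD i f) := by
  obtain ⟨s, h1, h2, -⟩ := hf.exists_support hU hN
  refine IsDiffFun.congr (f := fun z => ∑ c ∈ s, shiftCoord i z c * JetCalculus.pd c f z) ?_
    fun z hz => totalD_eq_sum (fun c hc => h2 c hc z hz) i
  refine IsDiffFun.sum fun c _ => IsDiffFun.mul ?_ (h1 c)
  rcases c with j | c
  · exact IsDiffFun.const _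
  · exact IsDiffFun.coord _

theorem IsDiffFun.totalDJ (hU : IsOpen U) (hN : N + 1 ≤ N) (hf : IsDiffFun N U f)
    (J : MultiIdx p) : IsDiffFun N U (totalDJ J f) :=
  iterOp_pred (IsDiffFun N U) (fun i _ h => h.totalD hU hN i) J hf

theorem totalD_congr (hU : IsOpen U) (h : Set.EqOn f g U) (i : Fin p) :
    Set.EqOn (totalD i f) (totalD i g) U := by
  intro z hz
  simp only [totalD, pd_congr hU h _ hz]

theorem totalDJ_congr (hU : IsOpen U) (h : Set.EqOn f g U) (J : MultiIdx p) :
    Set.EqOn (totalDJ J f) (totalDJ J g) U :=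
  iterOp_rel (fun f g => Set.EqOn f g U) (fun i _ _ h => totalD_congr hU h i) J h

theorem totalDJ_zero_fun (J : MultiIdx p) :
    totalDJ J (fun _ : Jet p q => (0 : ℝ)) = fun _ => 0 :=
  iterOp_pred (fun f => f = fun _ : Jet p q => (0 : ℝ))
    (fun i f h => by rw [h]; funext z; simp [JetCalculus.totalD]) J rfl

end DiffFun

/-! ### Interchanging a parameter derivative with a space derivative. -/

section Swap

variable {p : ℕ} {F : ℝ × (Fin p → ℝ) → ℝ} {x : ℝ × (Fin p → ℝ)}

theorem hasDerivAt_prod_left (hF : DifferentiableAt ℝ F x) :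
    HasDerivAt (fun e => F (e, x.2)) (fderiv ℝ F x (1, 0)) x.1 := by
  have h : HasDerivAt (fun e : ℝ => (e, x.2)) ((1 : ℝ), (0 : Fin p → ℝ)) x.1 :=
    (hasDerivAt_id x.1).prodMk (hasDerivAt_const _ _)
  exact HasFDerivAt.comp_hasDerivAt (f := fun e : ℝ => (e, x.2)) x.1
    (show HasFDerivAt F (fderiv ℝ F x) (x.1, x.2) from hF.hasFDerivAt) h

theorem pd_prod_right (hF : DifferentiableAt ℝ F x) (i : Fin p) :
    pd i (fun y => F (x.1, y)) x.2 = fderiv ℝ F x (0, Pi.single i 1) := by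
  have h : HasDerivAt (fun r : ℝ => (x.1, Function.update x.2 i r))
      ((0 : ℝ), (Pi.single i 1 : Fin p → ℝ)) (x.2 i) :=
    (hasDerivAt_const _ _).prodMk (hasDerivAt_update x.2 i (x.2 i))
  exact (HasFDerivAt.comp_hasDerivAt (f := fun r : ℝ => (x.1, Function.update x.2 i r)) (x.2 i)
    (show HasFDerivAt F (fderiv ℝ F x) (x.1, Function.update x.2 i (x.2 i)) by
      simpa using hF.hasFDerivAt) h).deriv

theorem deriv_pd_comm (hF : ContDiffAt ℝ 2 F x) (i : Fin p) :
    deriv (fun e => pd i (fun y => F (e, y)) x.2) x.1 =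
      pd i (fun y => deriv (fun e => F (e, y)) x.1) x.2 := by
  have hev : ∀ᶠ x' in 𝓝 x, DifferentiableAt ℝ F x' := by
    filter_upwards [hF.eventually (by simp)] with x' hx'
    exact hx'.differentiableAt (by simp)
  have hd : ∀ v, DifferentiableAt ℝ (fun x' => fderiv ℝ F x' v) x := fun v =>
    ((hF.fderiv_right (m := 1) (by norm_num)).differentiableAt (by simp)).clm_apply
      (differentiableAt_const _)
  have h1 : Tendsto (fun e : ℝ => (e, x.2)) (𝓝 x.1) (𝓝 x) :=
    (Continuous.prodMk_left x.2).tendsto x.1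
  have h2 : Tendsto (fun y => (x.1, y)) (𝓝 x.2) (𝓝 x) :=
    (Continuous.prodMk_right x.1).tendsto x.2
  have e1 : (fun e => pd i (fun y => F (e, y)) x.2) =ᶠ[𝓝 x.1]
      fun e => fderiv ℝ F (e, x.2) (0, Pi.single i 1) := by
    filter_upwards [h1.eventually hev] with e he
    exact pd_prod_right he i
  have e2 : (fun y => deriv (fun e => F (e, y)) x.1) =ᶠ[𝓝 x.2]
      fun y => fderiv ℝ F (x.1, y) (1, 0) := by
    filter_upwards [h2.eventually hev] with y hy
    exact (hasDerivAt_prod_left hy).deriv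
  rw [e1.deriv_eq, pd_congr_of_eventuallyEq e2, (hasDerivAt_prod_left (hd _)).deriv,
    pd_prod_right (hd _), fderiv_fderiv_apply_comm hF]

end Swap

/-! ### Linearization of differential functions along a map. -/

section Linearization

variable {p q : ℕ} {N : WithTop ℕ∞} {U : Set (Jet p q)} {Ω : Set (Fin p → ℝ)}
  {u w : (Fin p → ℝ) → (Fin q → ℝ)} {f g : Jet p q → ℝ}

/-- The infinite jet of `u + ε w`. -/
noncomputable def variedJet (u w : (Fin p → ℝ) → (Fin q → ℝ)) (ε : ℝ) (y : Fin p → ℝ) : Jet p q :=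
  Sum.elim y fun c => iterOp pd c.2 (fun x => u x c.1) y + ε * iterOp pd c.2 (fun x => w x c.1) y

@[simp] theorem variedJet_zero (y : Fin p → ℝ) : variedJet u w 0 y = jet u y := by
  simp [variedJet, jet]

/-- The linearization of `f` at `u`, applied to `w`. -/
noncomputable def lin (u w : (Fin p → ℝ) → (Fin q → ℝ)) (f : Jet p q → ℝ) (y : Fin p → ℝ) : ℝ :=
  ∑ᶠ c : Fin q × MultiIdx p, iterOp pd c.2 (fun x => w x c.1) y * pd (uc c.1 c.2) f (jet u y)

theorem contDiffAt_variedJet (hN : N + 1 ≤ N) (hu : ∀ a, IsCkOn N Ω fun y => u y a)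
    (hw : ∀ a, IsCkOn N Ω fun y => w y a) (ε : ℝ) {y : Fin p → ℝ} (hy : y ∈ Ω) (c : Coord p q) :
    ContDiffAt ℝ N (fun x : ℝ × (Fin p → ℝ) => variedJet u w x.1 x.2 c) (ε, y) := by
  rcases c with j | c
  · simp only [variedJet, Sum.elim_inl]; fun_prop
  · have h1 : ContDiffAt ℝ N (fun x : ℝ × (Fin p → ℝ) =>
        iterOp pd c.2 (fun x => u x c.1) x.2) (ε, y) :=
      ContDiffAt.comp (ε, y) ((hu c.1).iterPd hN c.2 y hy) contDiffAt_snd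
    have h2 : ContDiffAt ℝ N (fun x : ℝ × (Fin p → ℝ) =>
        iterOp pd c.2 (fun x => w x c.1) x.2) (ε, y) :=
      ContDiffAt.comp (ε, y) ((hw c.1).iterPd hN c.2 y hy) contDiffAt_snd
    exact h1.add (contDiffAt_fst.mul h2)

theorem eventually_variedJet_mem (hU : IsOpen U) (hu : ∀ a, IsCkOn ∞ Ω fun y => u y a)
    (hw : ∀ a, IsCkOn ∞ Ω fun y => w y a) {ε : ℝ} {y : Fin p → ℝ} (hy : y ∈ Ω)
    (hmem : variedJet u w ε y ∈ U) :
    ∀ᶠ x : ℝ × (Fin p → ℝ) in 𝓝 (ε, y), variedJet u w x.1 x.2 ∈ U := by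
  have : ContinuousAt (fun x : ℝ × (Fin p → ℝ) => variedJet u w x.1 x.2) (ε, y) :=
    tendsto_pi_nhds.2 fun c => (contDiffAt_variedJet (by simp) hu hw ε hy c).continuousAt
  exact this.eventually (hU.mem_nhds hmem)

theorem IsDiffFun.contDiffAt_variedJet (hU : IsOpen U) (hN : N + 1 ≤ N) (hN' : ∞ ≤ N)
    (hf : IsDiffFun N U f) (hu : ∀ a, IsCkOn N Ω fun y => u y a)
    (hw : ∀ a, IsCkOn N Ω fun y => w y a) {ε : ℝ} {y : Fin p → ℝ} (hy : y ∈ Ω)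
    (hmem : variedJet u w ε y ∈ U) :
    ContDiffAt ℝ N (fun x : ℝ × (Fin p → ℝ) => f (variedJet u w x.1 x.2)) (ε, y) := by
  obtain ⟨s, G, hG⟩ := hf
  have h1 : ContDiffAt ℝ N
      (fun x : ℝ × (Fin p → ℝ) => G fun c : s => variedJet u w x.1 x.2 c) (ε, y) :=
    ContDiffAt.comp (g := G) (ε, y) (hG _ hmem).1
      (contDiffAt_pi.2 fun c => JetCalculus.contDiffAt_variedJet hN hu hw ε hy c)
  refine h1.congr_of_eventuallyEq ?_
  filter_upwards [eventually_variedJet_mem hU (fun a => (hu a).of_le hN')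
    (fun a => (hw a).of_le hN') hy hmem] with x hx
  exact (hG _ hx).2

theorem IsDiffFun.along (hU : IsOpen U) (hN : N + 1 ≤ N) (hN' : ∞ ≤ N)
    (hf : IsDiffFun N U f) (hu : ∀ a, IsCkOn N Ω fun y => u y a) (hj : ∀ y ∈ Ω, jet u y ∈ U) :
    IsCkOn N Ω fun y => f (jet u y) := by
  intro y hy
  have h := hf.contDiffAt_variedJet hU hN hN' hu (w := u) hu (ε := 0) hy (by simpa using hj y hy)
  have h2 := ContDiffAt.comp (f := fun y : Fin p → ℝ => ((0 : ℝ), y)) y h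
    (contDiffAt_const.prodMk contDiffAt_id)
  refine h2.congr_of_eventuallyEq (Eventually.of_forall fun y' => ?_)
  simp

/-- Chain rule: jets of maps are holonomic, so their velocity in direction `i` is `shiftCoord i`.
General `ε` is needed because `lin_totalD` differentiates this identity in `ε`. -/
theorem pd_along_variedJet (hU : IsOpen U) (hΩ : IsOpen Ω) (hf : IsDiffFun ∞ U f)
    (hu : ∀ a, IsCkOn ∞ Ω fun y => u y a) (hw : ∀ a, IsCkOn ∞ Ω fun y => w y a) {ε : ℝ}
    {y : Fin p → ℝ} (hy : y ∈ Ω) (hmem : variedJet u w ε y ∈ U) (i : Fin p) :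
    pd i (fun y => f (variedJet u w ε y)) y = totalD i f (variedJet u w ε y) := by
  obtain ⟨s, -, h0, hch⟩ := hf.exists_support hU (by simp)
  rw [totalD_eq_sum (fun c hc => h0 c hc _ hmem) i]
  have e : Function.update y i (y i) = y := Function.update_eq_self i y
  have h := hch (fun r => variedJet u w ε (Function.update y i r))
    (shiftCoord i (variedJet u w ε y)) (y i) (by simpa [e] using hmem) ?_
  · rw [pd, h.deriv, e]
  · rintro (j | c)
    · simp only [variedJet, shiftCoord, Sum.elim_inl]
      exact hasDerivAt_pi.1 (hasDerivAt_update y i (y i)) j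
    · have key : ∀ v : (Fin p → ℝ) → (Fin q → ℝ), (∀ a, IsCkOn ∞ Ω fun y => v y a) →
          HasDerivAt (fun r => iterOp pd c.2 (fun x => v x c.1) (Function.update y i r))
            (iterOp pd (c.2 + Pi.single i 1) (fun x => v x c.1) y) (y i) := by
        intro v hv
        have hd := ((hv c.1).iterPd (by simp) c.2).differentiableAt (by simp) hy
        have := hasDerivAt_pd hd i
        rwa [← pd_eq_fderiv hd, pd_iterPd hΩ (hv c.1) c.2 i hy] at this
      exact (key u hu).add ((key w hw).const_mul ε)

/-- Characterizes `lin` as an `ε`-derivative; the algebraic rules for `lin` below then follow from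
uniqueness of derivatives. -/
theorem hasDerivAt_along_variedJet (hU : IsOpen U) (hf : IsDiffFun ∞ U f)
    {y : Fin p → ℝ} (hmem : jet u y ∈ U) :
    HasDerivAt (fun ε => f (variedJet u w ε y)) (lin u w f y) 0 := by
  obtain ⟨s, -, h0, hch⟩ := hf.exists_support hU (by simp)
  have h := hch (fun ε => variedJet u w ε y)
    (Sum.elim 0 fun c => iterOp pd c.2 (fun x => w x c.1) y) 0 (by simpa using hmem) ?_
  · rw [sum_sumElim (F := fun c : Coord p q =>
      (Sum.elim 0 fun c => iterOp pd c.2 (fun x => w x c.1) y : Coord p q → ℝ) c *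
        pd c f (variedJet u w 0 y)) fun c hc => by
        simp only [variedJet_zero]; rw [h0 c hc _ hmem, mul_zero]] at h
    simpa [lin] using h
  · rintro (j | c)
    · simpa [variedJet] using hasDerivAt_const (0 : ℝ) (y j)
    · simpa [variedJet] using ((hasDerivAt_id (0 : ℝ)).mul_const
        (iterOp pd c.2 (fun x => w x c.1) y)).const_add (iterOp pd c.2 (fun x => u x c.1) y)

theorem pd_along (hU : IsOpen U) (hΩ : IsOpen Ω) (hf : IsDiffFun ∞ U f)
    (hu : ∀ a, IsCkOn ∞ Ω fun y => u y a) (hj : ∀ y ∈ Ω, jet u y ∈ U) (i : Fin p) :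
    Set.EqOn (pd i fun y => f (jet u y)) (fun y => totalD i f (jet u y)) Ω := by
  intro y hy
  simpa using pd_along_variedJet (w := u) (ε := 0) hU hΩ hf hu hu hy (by simpa using hj y hy) i

theorem iterPd_along (hU : IsOpen U) (hΩ : IsOpen Ω) (hf : IsDiffFun ∞ U f)
    (hu : ∀ a, IsCkOn ∞ Ω fun y => u y a) (hj : ∀ y ∈ Ω, jet u y ∈ U) (J : MultiIdx p) :
    Set.EqOn (fun y => totalDJ J f (jet u y)) (iterOp pd J fun y => f (jet u y)) Ω :=
  (iterOp_rel (fun f g => IsDiffFun ∞ U f ∧ Set.EqOn (fun y => f (jet u y)) g Ω)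
    (fun i _ _ h => ⟨h.1.totalD hU (by simp) i,
      (pd_along hU hΩ h.1 hu hj i).symm.trans (pd_congr hΩ h.2 i)⟩) J
    ⟨hf, Set.eqOn_refl _ _⟩).2

theorem iterate_pd_along (hU : IsOpen U) (hΩ : IsOpen Ω) (hf : IsDiffFun ∞ U f)
    (hu : ∀ a, IsCkOn ∞ Ω fun y => u y a) (hj : ∀ y ∈ Ω, jet u y ∈ U) (i : Fin p) (k : ℕ) :
    Set.EqOn (fun y => (totalD i)^[k] f (jet u y)) ((pd i)^[k] fun y => f (jet u y)) Ω := by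
  simpa only [totalDJ, iterOp_single] using iterPd_along hU hΩ hf hu hj (Pi.single i k)

theorem lin_congr (hU : IsOpen U) (h : Set.EqOn f g U) (hj : ∀ y ∈ Ω, jet u y ∈ U) :
    Set.EqOn (lin u w f) (lin u w g) Ω := by
  intro y hy
  simp only [lin, pd_congr hU h _ (hj y hy)]

theorem lin_sub (hU : IsOpen U) (hf : IsDiffFun ∞ U f) (hg : IsDiffFun ∞ U g)
    {y : Fin p → ℝ} (hy : jet u y ∈ U) :
    lin u w (fun z => f z - g z) y = lin u w f y - lin u w g y :=
  (hasDerivAt_along_variedJet hU (hf.sub hg) hy).unique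
    ((hasDerivAt_along_variedJet hU hf hy).sub (hasDerivAt_along_variedJet hU hg hy))

theorem lin_mul (hU : IsOpen U) (hf : IsDiffFun ∞ U f) (hg : IsDiffFun ∞ U g)
    {y : Fin p → ℝ} (hy : jet u y ∈ U) :
    lin u w (fun z => f z * g z) y =
      lin u w f y * g (jet u y) + f (jet u y) * lin u w g y := by
  have h := (hasDerivAt_along_variedJet (w := w) hU hf hy).mul
    (hasDerivAt_along_variedJet (w := w) hU hg hy)
  simp only [variedJet_zero] at h
  exact (hasDerivAt_along_variedJet hU (hf.mul hg) hy).unique h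

theorem lin_const (r : ℝ) : lin u w (fun _ : Jet p q => r) = fun _ => 0 := by
  funext y
  simp [lin, pd]

theorem lin_sum (hU : IsOpen U) {ι : Type*} {s : Finset ι} {f : ι → Jet p q → ℝ}
    (hf : ∀ i ∈ s, IsDiffFun ∞ U (f i)) {y : Fin p → ℝ} (hy : jet u y ∈ U) :
    lin u w (fun z => ∑ i ∈ s, f i z) y = ∑ i ∈ s, lin u w (f i) y :=
  (hasDerivAt_along_variedJet hU (IsDiffFun.sum hf) hy).unique
    (HasDerivAt.fun_sum fun i hi => hasDerivAt_along_variedJet hU (hf i hi) hy)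

/-- Both sides are mixed second derivatives, in `ε` and `y i`, of `f` along the jets of `u + ε w`.
-/
theorem lin_totalD (hU : IsOpen U) (hΩ : IsOpen Ω) (hf : IsDiffFun ∞ U f)
    (hu : ∀ a, IsCkOn ∞ Ω fun y => u y a) (hw : ∀ a, IsCkOn ∞ Ω fun y => w y a)
    (hj : ∀ y ∈ Ω, jet u y ∈ U) (i : Fin p) :
    Set.EqOn (lin u w (totalD i f)) (pd i (lin u w f)) Ω := by
  intro y hy
  have hmem : variedJet u w 0 y ∈ U := by simpa using hj y hy
  have hC := (hf.contDiffAt_variedJet hU (by simp) le_rfl hu hw hy hmem).of_le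
    (m := 2) (WithTop.coe_le_coe.2 le_top)
  have hs := deriv_pd_comm hC i
  have e1 : (fun ε => pd i (fun y => f (variedJet u w ε y)) y) =ᶠ[𝓝 0]
      fun ε => totalD i f (variedJet u w ε y) := by
    filter_upwards [((Continuous.prodMk_left y).tendsto (0 : ℝ)).eventually
      (eventually_variedJet_mem hU hu hw hy hmem)] with ε hε
    exact pd_along_variedJet hU hΩ hf hu hw hy hε i
  have e2 : Set.EqOn (fun y => deriv (fun ε => f (variedJet u w ε y)) 0) (lin u w f) Ω :=
    fun y hy => (hasDerivAt_along_variedJet hU hf (hj y hy)).deriv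
  simp only at hs
  rw [e1.deriv_eq, (hasDerivAt_along_variedJet hU (hf.totalD hU (by simp) i) (hj y hy)).deriv,
    pd_congr hΩ e2 i hy] at hs
  exact hs

theorem lin_totalDJ (hU : IsOpen U) (hΩ : IsOpen Ω) (hf : IsDiffFun ∞ U f)
    (hu : ∀ a, IsCkOn ∞ Ω fun y => u y a) (hw : ∀ a, IsCkOn ∞ Ω fun y => w y a)
    (hj : ∀ y ∈ Ω, jet u y ∈ U) (J : MultiIdx p) :
    Set.EqOn (lin u w (totalDJ J f)) (iterOp pd J (lin u w f)) Ω :=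
  (iterOp_rel (fun f g => IsDiffFun ∞ U f ∧ Set.EqOn (lin u w f) g Ω)
    (fun i _ _ h => ⟨h.1.totalD hU (by simp) i,
      (lin_totalD hU hΩ h.1 hu hw hj i).trans (pd_congr hΩ h.2 i)⟩) J
    ⟨hf, Set.eqOn_refl _ _⟩).2

theorem finsum_eq_sum_univ_product {s : Finset (MultiIdx p)} {F : Fin q × MultiIdx p → ℝ}
    (h : ∀ a, ∀ J ∉ s, F (a, J) = 0) : ∑ᶠ c, F c = ∑ c ∈ Finset.univ ×ˢ s, F c := by
  refine finsum_eq_sum_of_support_subset _ fun c hc => ?_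
  by_contra hcs
  exact hc (h c.1 c.2 (by simpa using hcs))

theorem lin_eq_sum {s : Finset (MultiIdx p)}
    (h : ∀ a, ∀ J ∉ s, ∀ z ∈ U, pd (uc a J) f z = 0) (hj : ∀ y ∈ Ω, jet u y ∈ U) :
    Set.EqOn (lin u w f) (fun y => ∑ c ∈ Finset.univ ×ˢ s,
      iterOp pd c.2 (fun x => w x c.1) y * pd (uc c.1 c.2) f (jet u y)) Ω := fun y hy =>
  finsum_eq_sum_univ_product fun a J hJ => by simp only [h a J hJ _ (hj y hy), mul_zero]

theorem evol_eq_sum {s : Finset (MultiIdx p)}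
    (h : ∀ a, ∀ J ∉ s, ∀ z ∈ U, pd (uc a J) f z = 0) (α : Fin q → Jet p q → ℝ) :
    Set.EqOn (evol α f) (fun z => ∑ c ∈ Finset.univ ×ˢ s,
      totalDJ c.2 (α c.1) z * pd (uc c.1 c.2) f z) U := fun z hz =>
  finsum_eq_sum_univ_product fun a J hJ => by simp only [h a J hJ z hz, mul_zero]

theorem euler_eq_sum (hU : IsOpen U) {s : Finset (MultiIdx p)}
    (h : ∀ a, ∀ J ∉ s, ∀ z ∈ U, pd (uc a J) f z = 0) (a : Fin q) :
    Set.EqOn (euler a f) (fun z => ∑ J ∈ s,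
      (-1) ^ J.len * totalDJ J (pd (uc a J) f) z) U := by
  intro z hz
  refine finsum_eq_sum_of_support_subset _ fun J hJ => ?_
  by_contra hJs
  refine hJ ?_
  simp only
  rw [totalDJ_congr hU (h a J hJs) J hz, totalDJ_zero_fun, mul_zero]

theorem IsDiffFun.exists_finset (hU : IsOpen U) (hN : N + 1 ≤ N) (hf : IsDiffFun N U f) :
    ∃ s : Finset (MultiIdx p), ∀ a, ∀ J ∉ s, ∀ z ∈ U, JetCalculus.pd (uc a J) f z = 0 := by
  classical
  obtain ⟨s, -, h, -⟩ := hf.exists_support hU hN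
  refine ⟨s.toRight.image Prod.snd, fun a J hJ => h _ fun hs => hJ ?_⟩
  exact Finset.mem_image.2 ⟨(a, J), by simpa using hs, rfl⟩

theorem IsDiffFun.euler (hU : IsOpen U) (hf : IsDiffFun ∞ U f) (a : Fin q) :
    IsDiffFun ∞ U (euler a f) := by
  obtain ⟨s, hs⟩ := hf.exists_finset hU (by simp)
  exact (IsDiffFun.sum fun J _ => (IsDiffFun.const _).mul
    ((hf.pd hU (by simp) _).totalDJ hU (by simp) J)).congr (euler_eq_sum hU hs a)

theorem lin_coord {a : Fin q} {J : MultiIdx p} :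
    lin u w (fun z => z (uc a J)) = iterOp pd J fun x => w x a := by
  funext y
  have h := hasDerivAt_along_variedJet (u := u) (w := w) (U := Set.univ)
    (f := fun z => z (uc a J)) isOpen_univ (IsDiffFun.coord _) (y := y) trivial
  refine h.unique ?_
  simpa [variedJet] using ((hasDerivAt_id (0 : ℝ)).mul_const
    (iterOp pd J (fun x => w x a) y)).const_add (iterOp pd J (fun x => u x a) y)

theorem IsDiffFun.lin (hU : IsOpen U) (hΩ : IsOpen Ω) (hf : IsDiffFun ∞ U f)
    (hu : ∀ a, IsCkOn ∞ Ω fun y => u y a) (hw : ∀ a, IsCkOn ∞ Ω fun y => w y a)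
    (hj : ∀ y ∈ Ω, jet u y ∈ U) : IsCkOn ∞ Ω (lin u w f) := by
  obtain ⟨s, hs⟩ := hf.exists_finset hU (by simp)
  refine IsCkOn.congr hΩ (IsCkOn.sum fun c _ => ?_) (lin_eq_sum hs hj)
  exact ((hw c.1).iterPd (by simp) c.2).mul
    ((hf.pd hU (by simp) _).along hU (by simp) le_rfl hu hj)

end Linearization

/-! ### Test functions, integration by parts, and the fundamental lemma of the calculus of
variations. -/

section TestFunctions

variable {p q : ℕ} {Ω : Set (Fin p → ℝ)} {φ ψ χ : (Fin p → ℝ) → ℝ}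

/-- `ψ` is a smooth function with compact support in `Ω`. -/
def IsTest (Ω : Set (Fin p → ℝ)) (ψ : (Fin p → ℝ) → ℝ) : Prop :=
  IsCkOn ∞ Ω ψ ∧ ∃ K, IsCompact K ∧ K ⊆ Ω ∧ ∀ y ∉ K, ψ y = 0

theorem IsTest.contDiff (h : IsTest Ω ψ) : ContDiff ℝ ∞ ψ := by
  obtain ⟨h1, K, hK, hKΩ, h0⟩ := h
  refine contDiff_iff_contDiffAt.2 fun y => ?_
  by_cases hy : y ∈ K
  · exact h1 y (hKΩ hy)
  · refine (contDiffAt_const (c := (0 : ℝ))).congr_of_eventuallyEq ?_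
    filter_upwards [hK.isClosed.isOpen_compl.mem_nhds hy] with z hz using h0 z hz

theorem IsTest.hasCompactSupport (h : IsTest Ω ψ) : HasCompactSupport ψ := by
  obtain ⟨-, K, hK, -, h0⟩ := h
  exact HasCompactSupport.intro hK h0

theorem IsTest.integrable (h : IsTest Ω ψ) : Integrable ψ :=
  h.contDiff.continuous.integrable_of_hasCompactSupport h.hasCompactSupport

theorem IsTest.mul_left (h : IsTest Ω ψ) (hφ : IsCkOn ∞ Ω φ) : IsTest Ω fun y => φ y * ψ y := by
  obtain ⟨h1, K, hK, hKΩ, h0⟩ := h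
  exact ⟨hφ.mul h1, K, hK, hKΩ, fun y hy => by simp [h0 y hy]⟩

theorem IsTest.add (hφ : IsTest Ω φ) (hψ : IsTest Ω ψ) : IsTest Ω fun y => φ y + ψ y := by
  obtain ⟨h1, K, hK, hKΩ, h0⟩ := hφ
  obtain ⟨h1', K', hK', hKΩ', h0'⟩ := hψ
  refine ⟨h1.add h1', K ∪ K', hK.union hK', Set.union_subset hKΩ hKΩ', fun y hy => ?_⟩
  simp only
  rw [h0 y fun h => hy (Or.inl h), h0' y fun h => hy (Or.inr h), add_zero]

theorem IsTest.sum {ι : Type*} {s : Finset ι} {f : ι → (Fin p → ℝ) → ℝ}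
    (h : ∀ i ∈ s, IsTest Ω (f i)) : IsTest Ω fun y => ∑ i ∈ s, f i y := by
  refine ⟨IsCkOn.sum fun i hi => (h i hi).1, ?_⟩
  choose! K hK hKΩ h0 using fun i hi => (h i hi).2
  exact ⟨⋃ i ∈ s, K i, s.isCompact_biUnion hK, Set.iUnion₂_subset hKΩ, fun y hy =>
    Finset.sum_eq_zero fun i hi => h0 i hi y fun hyi => hy (Set.mem_biUnion hi hyi)⟩

theorem IsTest.pd (h : IsTest Ω ψ) (i : Fin p) : IsTest Ω (pd i ψ) := by
  obtain ⟨h1, K, hK, hKΩ, h0⟩ := h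
  refine ⟨h1.pd (by simp) i, K, hK, hKΩ, fun y hy => ?_⟩
  have : Set.EqOn ψ (fun _ => 0) Kᶜ := fun z hz => h0 z hz
  simpa using pd_congr hK.isClosed.isOpen_compl this i hy

theorem IsTest.iterPd (h : IsTest Ω ψ) (J : MultiIdx p) : IsTest Ω (iterOp JetCalculus.pd J ψ) :=
  iterOp_pred (IsTest Ω) (fun i _ h => h.pd i) J h

theorem isTest_zero : IsTest Ω fun _ => 0 :=
  ⟨IsCkOn.const 0, ∅, isCompact_empty, Set.empty_subset _, fun _ _ => rfl⟩

/-- Off `Ω` both functions vanish. The pointwise identities used later are known only on `Ω`,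
whereas the integrals run over the whole space. -/
theorem IsTest.congr_integral (h : IsTest Ω ψ) (hφ : IsTest Ω φ)
    (he : Set.EqOn φ ψ Ω) : ∫ y, φ y = ∫ y, ψ y := by
  congr 1
  funext y
  by_cases hy : y ∈ Ω
  · exact he hy
  · obtain ⟨-, K, -, hK, h0⟩ := h
    obtain ⟨-, K', -, hK', h0'⟩ := hφ
    rw [h0 y fun h => hy (hK h), h0' y fun h => hy (hK' h)]

theorem IsTest.integral_pd (h : IsTest Ω ψ) (i : Fin p) : ∫ y, JetCalculus.pd i ψ y = 0 := by
  have hd : Differentiable ℝ ψ := h.contDiff.differentiable (by simp)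
  have e : JetCalculus.pd i ψ = fun y => fderiv ℝ ψ y (Pi.single i 1) :=
    funext fun y => pd_eq_fderiv (hd y) i
  have hi := (h.pd i).integrable
  rw [e] at hi ⊢
  -- Integration by parts against the constant function `1`.
  have := integral_mul_fderiv_eq_neg_fderiv_mul_of_integrable (μ := volume) (𝕜 := ℝ)
    (f := fun _ : Fin p → ℝ => (1 : ℝ)) (g := ψ) (v := Pi.single i 1)
    (by simp) (by simpa using hi) (by simpa using h.integrable)
    (by simp) (fun y _ => hd y)
  simpa using this

/-- The product `φ ψ` is a test function even though `φ` is controlled only on `Ω`, so there is no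
boundary term. -/
theorem integral_mul_pd (hφ : IsCkOn ∞ Ω φ) (hψ : IsTest Ω ψ) (i : Fin p) :
    ∫ y, φ y * pd i ψ y = -∫ y, pd i φ y * ψ y := by
  have h1 := (hψ.pd i).mul_left hφ
  have h2 := hψ.mul_left (hφ.pd (by simp) i)
  have h3 := (hψ.mul_left hφ).integral_pd i
  rw [eq_neg_iff_add_eq_zero, ← integral_add h1.integrable h2.integrable, ← h3]
  refine IsTest.congr_integral ((hψ.mul_left hφ).pd i) (h1.add h2) fun y hy => ?_
  rw [pd_mul (hφ.differentiableAt (by simp) hy) (hψ.1.differentiableAt (by simp) hy)]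
  ring

/-- Integration by parts. -/
theorem integral_mul_iterPd (hΩ : IsOpen Ω) (hφ : IsCkOn ∞ Ω φ) (hψ : IsTest Ω ψ)
    (J : MultiIdx p) :
    ∫ y, φ y * iterOp pd J ψ y = (-1) ^ J.len * ∫ y, iterOp pd J φ y * ψ y := by
  induction J using MultiIdx.induction generalizing φ ψ with
  | h0 => simp [MultiIdx.len]
  | h1 J i ih =>
    have e1 : ∫ y, φ y * iterOp pd (J + Pi.single i 1) ψ y =
        ∫ y, φ y * pd i (iterOp pd J ψ) y :=
      IsTest.congr_integral (((hψ.iterPd J).pd i).mul_left hφ)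
        ((hψ.iterPd _).mul_left hφ) fun y hy => by
          simp only [pd_iterPd hΩ hψ.1 J i hy]
    have e2 : ∫ y, iterOp pd (J + Pi.single i 1) φ y * ψ y =
        ∫ y, pd i (iterOp pd J φ) y * ψ y :=
      IsTest.congr_integral (hψ.mul_left ((hφ.iterPd (by simp) J).pd (by simp) i))
        (hψ.mul_left (hφ.iterPd (by simp) _)) fun y hy => by
          simp only [pd_iterPd hΩ hφ J i hy]
    rw [e1, e2, integral_mul_pd hφ (hψ.iterPd J), ih (hφ.pd (by simp) i) hψ,
      MultiIdx.len_add_single, pow_succ]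
    have e3 : ∫ y, iterOp pd J (pd i φ) y * ψ y = ∫ y, pd i (iterOp pd J φ) y * ψ y :=
      IsTest.congr_integral (hψ.mul_left ((hφ.iterPd (by simp) J).pd (by simp) i))
        (hψ.mul_left ((hφ.pd (by simp) i).iterPd (by simp) J)) fun y hy => by
          simp only [iterPd_pd hΩ hφ J i hy]
    rw [e3]; ring

theorem integral_iterPd_mul (hΩ : IsOpen Ω) (hφ : IsCkOn ∞ Ω φ) (hψ : IsTest Ω ψ)
    (J : MultiIdx p) :
    ∫ y, iterOp pd J φ y * ψ y = (-1) ^ J.len * ∫ y, φ y * iterOp pd J ψ y := by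
  rw [integral_mul_iterPd hΩ hφ hψ, ← mul_assoc, ← mul_pow]; simp

/-- The fundamental lemma gives vanishing almost everywhere; continuity upgrades it to all of `Ω`.
-/
theorem eqOn_zero_of_integral_eq_zero (hΩ : IsOpen Ω) (hφ : IsCkOn ∞ Ω φ)
    (h : ∀ ψ, IsTest Ω ψ → ∫ y, φ y * ψ y = 0) : Set.EqOn φ (fun _ => 0) Ω := by
  have hc : ContinuousOn φ Ω := fun y hy => (hφ y hy).continuousAt.continuousWithinAt
  have hae := hΩ.ae_eq_zero_of_integral_contDiff_smul_eq_zero (μ := volume)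
    (hc.locallyIntegrableOn hΩ.measurableSet) fun g hg hgc hgΩ => by
      have := h g ⟨fun y _ => hg.contDiffAt, tsupport g, hgc, hgΩ, fun y hy =>
        image_eq_zero_of_notMem_tsupport hy⟩
      simpa [mul_comm] using this
  refine Measure.eqOn_open_of_ae_eq (μ := volume) ?_ hΩ hc continuousOn_const
  exact (ae_restrict_iff' hΩ.measurableSet).2 hae

theorem integral_sum_mul_iterPd {ι : Type*} (hΩ : IsOpen Ω) (s : Finset ι)
    {c ψ : ι → (Fin p → ℝ) → ℝ} (hc : ∀ i ∈ s, IsCkOn ∞ Ω (c i)) (hψ : ∀ i ∈ s, IsTest Ω (ψ i))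
    (J : ι → MultiIdx p) :
    ∫ y, ∑ i ∈ s, c i y * iterOp pd (J i) (ψ i) y =
      ∫ y, ∑ i ∈ s, (-1) ^ (J i).len * iterOp pd (J i) (c i) y * ψ i y := by
  rw [integral_finsetSum _ fun i hi => (((hψ i hi).iterPd (J i)).mul_left (hc i hi)).integrable,
    integral_finsetSum _ fun i hi => ((hψ i hi).mul_left
      ((IsCkOn.const _).mul ((hc i hi).iterPd (by simp) (J i)))).integrable]
  refine Finset.sum_congr rfl fun i hi => ?_
  rw [integral_mul_iterPd hΩ (hc i hi) (hψ i hi)]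
  simp only [mul_assoc, integral_const_mul]

theorem integral_sum_iterPd_mul {ι : Type*} (hΩ : IsOpen Ω) (s : Finset ι)
    {c ψ : ι → (Fin p → ℝ) → ℝ} (hc : ∀ i ∈ s, IsCkOn ∞ Ω (c i)) (hψ : ∀ i ∈ s, IsTest Ω (ψ i))
    (J : ι → MultiIdx p) :
    ∫ y, ∑ i ∈ s, iterOp pd (J i) (c i) y * ψ i y =
      ∫ y, ∑ i ∈ s, c i y * ((-1) ^ (J i).len * iterOp pd (J i) (ψ i) y) := by
  rw [integral_finsetSum _ fun i hi => ((hψ i hi).mul_left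
      ((hc i hi).iterPd (by simp) (J i))).integrable,
    integral_finsetSum _ fun i hi => ((((hψ i hi).iterPd (J i)).mul_left
      (IsCkOn.const _)).mul_left (hc i hi)).integrable]
  refine Finset.sum_congr rfl fun i hi => ?_
  rw [integral_iterPd_mul hΩ (hc i hi) (hψ i hi), ← integral_const_mul]
  congr 1
  funext y
  ring

theorem eqOn_zero_of_integral_sum_eq_zero (hΩ : IsOpen Ω) {G : Fin q → (Fin p → ℝ) → ℝ}
    (hG : ∀ a, IsCkOn ∞ Ω (G a))
    (h : ∀ v : (Fin p → ℝ) → (Fin q → ℝ), (∀ a, IsTest Ω fun y => v y a) →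
      ∫ y, ∑ a, G a y * v y a = 0) (a : Fin q) : Set.EqOn (G a) (fun _ => 0) Ω := by
  refine eqOn_zero_of_integral_eq_zero hΩ (hG a) fun ψ hψ => ?_
  rw [← h (fun y b => if b = a then ψ y else 0) fun b => ?_]
  · simp
  · by_cases hb : b = a
    · simpa [hb] using hψ
    · simpa [hb] using isTest_zero

end TestFunctions

/-! ### Matrix differential operators along solutions. -/

section Operators

variable {p q : ℕ} {N : WithTop ℕ∞} {U : Set (Jet p q)} {Ω : Set (Fin p → ℝ)}
  {u w : (Fin p → ℝ) → (Fin q → ℝ)}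

theorem DiffOp.exists_finset (T : DiffOp p q) : ∃ s : Finset (MultiIdx p),
    (∀ F a z, T.app F a z = ∑ c ∈ Finset.univ ×ˢ s, T a c.1 c.2 z * totalDJ c.2 (F c.1) z) ∧
    ∀ α b z, T.adj α b z = ∑ c ∈ Finset.univ ×ˢ s,
      (-1) ^ c.2.len * totalDJ c.2 (fun w => T c.1 b c.2 w * α c.1 w) z := by
  classical
  refine ⟨Finset.univ.biUnion fun a => Finset.univ.biUnion fun b => (T a b).support,
    fun F a z => ?_, fun α b z => ?_⟩
  · rw [Finset.sum_product]
    refine Finset.sum_congr rfl fun b _ => Finsupp.sum_of_support_subset _ ?_ _ fun J _ => ?_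
    · exact fun J hJ => Finset.mem_biUnion.2 ⟨a, Finset.mem_univ _,
        Finset.mem_biUnion.2 ⟨b, Finset.mem_univ _, hJ⟩⟩
    · simp
  · rw [Finset.sum_product]
    refine Finset.sum_congr rfl fun a _ => Finsupp.sum_of_support_subset _ ?_ _ fun J _ => ?_
    · exact fun J hJ => Finset.mem_biUnion.2 ⟨a, Finset.mem_univ _,
        Finset.mem_biUnion.2 ⟨b, Finset.mem_univ _, hJ⟩⟩
    · simp [totalDJ_zero_fun]

theorem DiffOp.IsClass.app {T : DiffOp p q} (hT : T.IsClass N U) (hU : IsOpen U)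
    (hN : N + 1 ≤ N) {F : Fin q → Jet p q → ℝ} (hF : ∀ a, IsDiffFun N U (F a)) (a : Fin q) :
    IsDiffFun N U (T.app F a) := by
  obtain ⟨s, hs, -⟩ := T.exists_finset
  rw [funext (hs F a)]
  exact IsDiffFun.sum fun c _ => (hT _ _ _).mul ((hF _).totalDJ hU hN _)

theorem DiffOp.IsClass.adj {T : DiffOp p q} (hT : T.IsClass N U) (hU : IsOpen U)
    (hN : N + 1 ≤ N) {α : Fin q → Jet p q → ℝ} (hα : ∀ a, IsDiffFun N U (α a)) (b : Fin q) :
    IsDiffFun N U (T.adj α b) := by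
  obtain ⟨s, -, hs⟩ := T.exists_finset
  rw [funext (hs α b)]
  exact IsDiffFun.sum fun c _ =>
    (IsDiffFun.const _).mul (((hT _ _ _).mul (hα _)).totalDJ hU hN _)

theorem totalDJ_along_eq_zero (hU : IsOpen U) (hΩ : IsOpen Ω) {f : Jet p q → ℝ}
    (hf : IsDiffFun ∞ U f) (hu : ∀ a, IsCkOn ∞ Ω fun y => u y a) (hj : ∀ y ∈ Ω, jet u y ∈ U)
    (h0 : ∀ y ∈ Ω, f (jet u y) = 0) (J : MultiIdx p) :
    ∀ y ∈ Ω, totalDJ J f (jet u y) = 0 := by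
  intro y hy
  have h1 := iterPd_along hU hΩ hf hu hj J hy
  have h2 := iterPd_congr hΩ (g := fun _ => 0) h0 J hy
  rw [iterPd_zero_fun] at h2
  exact h1.trans h2

theorem app_along_eq_zero (hU : IsOpen U) (hΩ : IsOpen Ω) (T : DiffOp p q)
    {F : Fin q → Jet p q → ℝ} (hF : ∀ a, IsDiffFun ∞ U (F a))
    (hu : ∀ a, IsCkOn ∞ Ω fun y => u y a) (hj : ∀ y ∈ Ω, jet u y ∈ U)
    (h0 : ∀ a, ∀ y ∈ Ω, F a (jet u y) = 0) (a : Fin q) :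
    ∀ y ∈ Ω, T.app F a (jet u y) = 0 := by
  intro y hy
  obtain ⟨s, hs, -⟩ := T.exists_finset
  rw [hs]
  exact Finset.sum_eq_zero fun c _ => by
    rw [totalDJ_along_eq_zero hU hΩ (hF c.1) hu hj (h0 c.1) c.2 y hy, mul_zero]

/-- The product rule also varies the coefficients of `T`, but those terms carry a factor `D_J F`,
which is zero on solutions of `F = 0`. -/
theorem lin_app (hU : IsOpen U) (hΩ : IsOpen Ω) {T : DiffOp p q} (hT : T.IsClass ∞ U)
    {s : Finset (MultiIdx p)} {F : Fin q → Jet p q → ℝ}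
    (hs : ∀ a z, T.app F a z = ∑ c ∈ Finset.univ ×ˢ s, T a c.1 c.2 z * totalDJ c.2 (F c.1) z)
    (hF : ∀ a, IsDiffFun ∞ U (F a)) (hu : ∀ a, IsCkOn ∞ Ω fun y => u y a)
    (hw : ∀ a, IsCkOn ∞ Ω fun y => w y a) (hj : ∀ y ∈ Ω, jet u y ∈ U)
    (h0 : ∀ a, ∀ y ∈ Ω, F a (jet u y) = 0) (a : Fin q) :
    Set.EqOn (lin u w (T.app F a)) (fun y => ∑ c ∈ Finset.univ ×ˢ s,
      T a c.1 c.2 (jet u y) * iterOp pd c.2 (lin u w (F c.1)) y) Ω := by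
  intro y hy
  rw [funext (hs a), lin_sum hU (fun c _ => (hT _ _ _).mul ((hF _).totalDJ hU (by simp) _))
    (hj y hy)]
  refine Finset.sum_congr rfl fun c _ => ?_
  rw [lin_mul hU (hT _ _ _) ((hF _).totalDJ hU (by simp) _) (hj y hy),
    totalDJ_along_eq_zero hU hΩ (hF c.1) hu hj (h0 c.1) c.2 y hy,
    lin_totalDJ hU hΩ (hF c.1) hu hw hj c.2 hy]
  ring

theorem lin_app_eq_zero (hU : IsOpen U) (hΩ : IsOpen Ω) {T : DiffOp p q} (hT : T.IsClass ∞ U)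
    {F : Fin q → Jet p q → ℝ} (hF : ∀ a, IsDiffFun ∞ U (F a))
    (hu : ∀ a, IsCkOn ∞ Ω fun y => u y a) (hw : ∀ a, IsCkOn ∞ Ω fun y => w y a)
    (hj : ∀ y ∈ Ω, jet u y ∈ U) (h0 : ∀ a, ∀ y ∈ Ω, F a (jet u y) = 0)
    (hl : ∀ a, ∀ y ∈ Ω, lin u w (F a) y = 0) (a : Fin q) :
    ∀ y ∈ Ω, lin u w (T.app F a) y = 0 := by
  intro y hy
  obtain ⟨s, hs, -⟩ := T.exists_finset
  rw [lin_app hU hΩ hT (hs F) hF hu hw hj h0 a hy]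
  refine Finset.sum_eq_zero fun c _ => ?_
  have h2 := iterPd_congr hΩ (g := fun _ => 0) (hl c.1) c.2 hy
  rw [iterPd_zero_fun] at h2
  rw [h2, mul_zero]

/-- Off the supports of the components of `w` all their derivatives vanish, so the uncontrolled
values of `u` outside `Ω` do no harm. -/
theorem isTest_lin (hU : IsOpen U) (hΩ : IsOpen Ω) {f : Jet p q → ℝ} (hf : IsDiffFun ∞ U f)
    (hu : ∀ a, IsCkOn ∞ Ω fun y => u y a) (hw : ∀ a, IsTest Ω fun y => w y a)
    (hj : ∀ y ∈ Ω, jet u y ∈ U) : IsTest Ω (lin u w f) := by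
  refine ⟨hf.lin hU hΩ hu (fun a => (hw a).1) hj, ?_⟩
  choose K hK hKΩ h0 using fun a => (hw a).2
  refine ⟨⋃ a, K a, isCompact_iUnion hK, Set.iUnion_subset hKΩ, fun y hy => ?_⟩
  rw [lin]
  refine finsum_eq_zero_of_forall_eq_zero fun c => ?_
  have hyc : y ∈ (K c.1)ᶜ := fun h => hy (Set.mem_iUnion.2 ⟨c.1, h⟩)
  have h2 := iterPd_congr (hK c.1).isClosed.isOpen_compl
    (f := fun x => w x c.1) (g := fun _ => 0) (fun z hz => h0 c.1 z hz) c.2 hyc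
  rw [iterPd_zero_fun] at h2
  rw [h2, zero_mul]

end Operators

/-! ### Variational symmetries and the linearized Euler–Lagrange operator. -/

section Duality

variable {p q : ℕ} {U : Set (Jet p q)} {Ω : Set (Fin p → ℝ)}
  {u w : (Fin p → ℝ) → (Fin q → ℝ)} {L : Jet p q → ℝ} {α : Fin q → Jet p q → ℝ}

theorem euler_along (hU : IsOpen U) (hΩ : IsOpen Ω) (hL : IsDiffFun ∞ U L)
    {s : Finset (MultiIdx p)} (hs : ∀ a, ∀ J ∉ s, ∀ z ∈ U, pd (uc a J) L z = 0)
    (hu : ∀ a, IsCkOn ∞ Ω fun y => u y a) (hj : ∀ y ∈ Ω, jet u y ∈ U) (a : Fin q) :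
    Set.EqOn (fun y => euler a L (jet u y)) (fun y => ∑ J ∈ s,
      (-1) ^ J.len * iterOp pd J (fun y => pd (uc a J) L (jet u y)) y) Ω := by
  intro y hy
  simp only
  rw [euler_eq_sum hU hs a (hj y hy)]
  refine Finset.sum_congr rfl fun J _ => ?_
  rw [← iterPd_along hU hΩ (hL.pd hU (by simp) _) hu hj J hy]

theorem lin_euler (hU : IsOpen U) (hΩ : IsOpen Ω) (hL : IsDiffFun ∞ U L)
    {s : Finset (MultiIdx p)} (hs : ∀ a, ∀ J ∉ s, ∀ z ∈ U, pd (uc a J) L z = 0)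
    (hu : ∀ a, IsCkOn ∞ Ω fun y => u y a) (hw : ∀ a, IsCkOn ∞ Ω fun y => w y a)
    (hj : ∀ y ∈ Ω, jet u y ∈ U) (a : Fin q) :
    Set.EqOn (lin u w (euler a L)) (fun y => ∑ J ∈ s,
      (-1) ^ J.len * iterOp pd J (lin u w (pd (uc a J) L)) y) Ω := by
  have hd : ∀ J, IsDiffFun ∞ U (totalDJ J (pd (uc a J) L)) := fun J =>
    (hL.pd hU (by simp) _).totalDJ hU (by simp) J
  intro y hy
  rw [lin_congr hU (euler_eq_sum hU hs a) hj hy,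
    lin_sum hU (fun J _ => (IsDiffFun.const _).mul (hd J)) (hj y hy)]
  refine Finset.sum_congr rfl fun J _ => ?_
  rw [lin_mul hU (IsDiffFun.const _) (hd J) (hj y hy), lin_const,
    lin_totalDJ hU hΩ (hL.pd hU (by simp) _) hu hw hj J hy]
  ring

/-- On a solution of the Euler-Lagrange equations `E(L) = 0`, a variational symmetry `α` is
orthogonal to the image of the linearized equations. -/
theorem integral_mul_lin_euler_eq_zero (hU : IsOpen U) (hΩ : IsOpen Ω) (hL : IsDiffFun ∞ U L)
    (hα : ∀ a, IsDiffFun ∞ U (α a)) (hX : IsDivergence U (evol α L))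
    (hu : ∀ a, IsCkOn ∞ Ω fun y => u y a) (hw : ∀ a, IsTest Ω fun y => w y a)
    (hj : ∀ y ∈ Ω, jet u y ∈ U) (h0 : ∀ a, ∀ y ∈ Ω, euler a L (jet u y) = 0) :
    ∫ y, ∑ a, α a (jet u y) * lin u w (euler a L) y = 0 := by
  obtain ⟨s, hs⟩ := hL.exists_finset hU (by simp)
  obtain ⟨M, hM, hMe⟩ := hX
  have hws : ∀ a, IsCkOn ∞ Ω fun y => w y a := fun a => (hw a).1
  have hP : ∀ c : Coord p q, IsDiffFun ∞ U (pd c L) := fun c => hL.pd hU (by simp) c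
  have along : ∀ {f}, IsDiffFun ∞ U f → IsCkOn ∞ Ω fun y => f (jet u y) := fun hf =>
    hf.along hU (by simp) le_rfl hu hj
  have test : ∀ {f}, IsDiffFun ∞ U f → IsTest Ω (lin u w f) := fun hf =>
    isTest_lin hU hΩ hf hu hw hj
  set S : Finset (Fin q × MultiIdx p) := Finset.univ ×ˢ s with hS
  -- `t1` and `t2` concern the two halves of the product rule for the linearization of `X_α L`: `α`
  -- varied, and `∂L/∂u^a_J` varied.
  have t1 : IsTest Ω fun y => ∑ c ∈ S,
      pd (uc c.1 c.2) L (jet u y) * iterOp pd c.2 (lin u w (α c.1)) y :=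
    IsTest.sum fun c _ => ((test (hα c.1)).iterPd c.2).mul_left (along (hP _))
  have t2 : IsTest Ω fun y => ∑ c ∈ S,
      iterOp pd c.2 (fun y => α c.1 (jet u y)) y * lin u w (pd (uc c.1 c.2) L) y :=
    IsTest.sum fun c _ => (test (hP _)).mul_left ((along (hα c.1)).iterPd (by simp) c.2)
  have t3 : ∀ i, IsTest Ω (pd i (lin u w (M i))) := fun i => (test (hM i)).pd i
  have hdiv : ∫ y, ∑ i, pd i (lin u w (M i)) y = 0 := by
    rw [integral_finsetSum _ fun i _ => (t3 i).integrable]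
    exact Finset.sum_eq_zero fun i _ => (test (hM i)).integral_pd i
  rw [← IsTest.congr_integral (IsTest.sum fun i _ => t3 i) (t1.add t2) ?_,
    integral_add t1.integrable t2.integrable,
    integral_sum_mul_iterPd hΩ S (c := fun c y => pd (uc c.1 c.2) L (jet u y))
      (ψ := fun c => lin u w (α c.1)) (fun c _ => along (hP _)) (fun c _ => test (hα c.1))
      fun c => c.2,
    integral_sum_iterPd_mul hΩ S (c := fun c y => α c.1 (jet u y))
      (ψ := fun c => lin u w (pd (uc c.1 c.2) L)) (fun c _ => along (hα c.1))
      (fun c _ => test (hP _)) fun c => c.2] at hdiv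
  -- After integration by parts the coefficient of `lin α^a` is `E_a(L)` along `u`, which is zero.
  · have z1 : ∫ y, ∑ c ∈ S, (-1) ^ c.2.len *
        iterOp pd c.2 (fun y => pd (uc c.1 c.2) L (jet u y)) y * lin u w (α c.1) y =
        ∫ _ : Fin p → ℝ, (0 : ℝ) := by
      refine IsTest.congr_integral isTest_zero (IsTest.sum fun c _ => (test (hα c.1)).mul_left
        ((IsCkOn.const _).mul ((along (hP _)).iterPd (by simp) c.2))) fun y hy => ?_
      simp only [hS, Finset.sum_product, ← Finset.sum_mul]
      refine Finset.sum_eq_zero fun a _ => ?_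
      have := euler_along hU hΩ hL hs hu hj a hy
      simp only [h0 a y hy] at this
      rw [← this, zero_mul]
    rw [z1, integral_zero, zero_add] at hdiv
    rw [← hdiv]
    refine IsTest.congr_integral (IsTest.sum fun c _ => (((test (hP _)).iterPd c.2).mul_left
      (IsCkOn.const _)).mul_left (along (hα c.1)))
      (IsTest.sum fun a _ => (test (hL.euler hU a)).mul_left (along (hα a))) fun y hy => ?_
    simp only [hS, Finset.sum_product, ← Finset.mul_sum]
    exact Finset.sum_congr rfl fun a _ => by rw [lin_euler hU hΩ hL hs hu hws hj a hy]
  · intro y hy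
    have e1 : lin u w (evol α L) y = ∑ i, pd i (lin u w (M i)) y := by
      rw [lin_congr hU hMe hj hy, lin_sum hU (fun i _ => (hM i).totalD hU (by simp) i) (hj y hy)]
      exact Finset.sum_congr rfl fun i _ => lin_totalD hU hΩ (hM i) hu hws hj i hy
    have hD : ∀ c : Fin q × MultiIdx p, IsDiffFun ∞ U (totalDJ c.2 (α c.1)) := fun c =>
      (hα c.1).totalDJ hU (by simp) c.2
    simp only
    rw [← e1, lin_congr hU (evol_eq_sum hs α) hj hy,
      lin_sum hU (fun c _ => (hD c).mul (hP _)) (hj y hy), ← Finset.sum_add_distrib]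
    refine Finset.sum_congr rfl fun c _ => ?_
    rw [lin_mul hU (hD c) (hP _) (hj y hy), lin_totalDJ hU hΩ (hα c.1) hu hws hj c.2 hy,
      ← iterPd_along hU hΩ (hα c.1) hu hj c.2 hy]
    ring

/-- A variational symmetry solves the linearized Euler-Lagrange equations on solutions. -/
theorem lin_euler_symmetry_eq_zero (hU : IsOpen U) (hΩ : IsOpen Ω) (hL : IsDiffFun ∞ U L)
    (hα : ∀ a, IsDiffFun ∞ U (α a)) (hX : IsDivergence U (evol α L))
    (hu : ∀ a, IsCkOn ∞ Ω fun y => u y a) (hj : ∀ y ∈ Ω, jet u y ∈ U)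
    (h0 : ∀ a, ∀ y ∈ Ω, euler a L (jet u y) = 0) (b : Fin q) :
    ∀ y ∈ Ω, lin u (fun y a => α a (jet u y)) (euler b L) y = 0 := by
  obtain ⟨s, hs⟩ := hL.exists_finset hU (by simp)
  have hP : ∀ c : Coord p q, IsDiffFun ∞ U (pd c L) := fun c => hL.pd hU (by simp) c
  have along : ∀ {f}, IsDiffFun ∞ U f → IsCkOn ∞ Ω fun y => f (jet u y) := fun hf =>
    hf.along hU (by simp) le_rfl hu hj
  set v : (Fin p → ℝ) → (Fin q → ℝ) := fun y a => α a (jet u y) with hv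
  have hvs : ∀ a, IsCkOn ∞ Ω fun y => v y a := fun a => along (hα a)
  have hvl : ∀ {f}, IsDiffFun ∞ U f → IsCkOn ∞ Ω (lin u v f) := fun hf =>
    hf.lin hU hΩ hu hvs hj
  -- The finite set for `L` also serves its first derivatives, so the Hessian of `L` is summed over
  -- `S` in both indices.
  have hs2 : ∀ (d : Coord p q) a, ∀ J ∉ s, ∀ z ∈ U, pd (uc a J) (pd d L) z = 0 := by
    intro d a J hJ z hz
    rw [hL.pd_comm hU (uc a J) d hz, pd_congr hU (g := fun _ => 0) (hs a J hJ) d hz, pd_zero]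
  refine eqOn_zero_of_integral_sum_eq_zero hΩ (G := fun b => lin u v (euler b L))
    (fun b => hvl (hL.euler hU b)) (fun w hw => ?_) b
  have hws : ∀ a, IsCkOn ∞ Ω fun y => w y a := fun a => (hw a).1
  have test : ∀ {f}, IsDiffFun ∞ U f → IsTest Ω (lin u w f) := fun hf =>
    isTest_lin hU hΩ hf hu hw hj
  set S : Finset (Fin q × MultiIdx p) := Finset.univ ×ˢ s with hS
  rw [← integral_mul_lin_euler_eq_zero hU hΩ hL hα hX hu hw hj h0]
  calc ∫ y, ∑ b, lin u v (euler b L) y * w y b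
      = ∫ y, ∑ d ∈ S, (-1) ^ d.2.len *
          iterOp pd d.2 (lin u v (pd (uc d.1 d.2) L)) y * w y d.1 := by
        refine IsTest.congr_integral (IsTest.sum fun d _ => (hw d.1).mul_left
          ((IsCkOn.const _).mul ((hvl (hP _)).iterPd (by simp) _)))
          (IsTest.sum fun b _ => (hw b).mul_left (hvl (hL.euler hU b))) fun y hy => ?_
        simp only [hS, Finset.sum_product, ← Finset.sum_mul]
        exact Finset.sum_congr rfl fun b _ => by rw [lin_euler hU hΩ hL hs hu hvs hj b hy]
    _ = ∫ y, ∑ d ∈ S, lin u v (pd (uc d.1 d.2) L) y * iterOp pd d.2 (fun y => w y d.1) y :=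
        (integral_sum_mul_iterPd hΩ S (c := fun d => lin u v (pd (uc d.1 d.2) L))
          (ψ := fun d y => w y d.1) (fun d _ => hvl (hP _)) (fun d _ => hw d.1)
          fun d => d.2).symm
    -- Self-adjointness: both integrands are the Hessian of `L` paired with the derivatives of
    -- `α[u]` and `w`, and the Hessian is symmetric.
    _ = ∫ y, ∑ c ∈ S, iterOp pd c.2 (fun y => α c.1 (jet u y)) y *
          lin u w (pd (uc c.1 c.2) L) y := by
        refine IsTest.congr_integral
          (IsTest.sum fun c _ => (test (hP _)).mul_left ((along (hα c.1)).iterPd (by simp) c.2))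
          (IsTest.sum fun d _ => ((hw d.1).iterPd d.2).mul_left (hvl (hP _))) fun y hy => ?_
        have e1 : ∀ d : Fin q × MultiIdx p, lin u v (pd (uc d.1 d.2) L) y = _ := fun d =>
          lin_eq_sum (hs2 _) hj hy
        have e2 : ∀ d : Fin q × MultiIdx p, lin u w (pd (uc d.1 d.2) L) y = _ := fun d =>
          lin_eq_sum (hs2 _) hj hy
        simp only [e1, e2, Finset.sum_mul, Finset.mul_sum]
        rw [Finset.sum_comm]
        refine Finset.sum_congr rfl fun c _ => Finset.sum_congr rfl fun d _ => ?_
        rw [hL.pd_comm hU (uc c.1 c.2) (uc d.1 d.2) (hj y hy)]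
        ring
    _ = ∫ y, ∑ c ∈ S, α c.1 (jet u y) *
          ((-1) ^ c.2.len * iterOp pd c.2 (lin u w (pd (uc c.1 c.2) L)) y) :=
        integral_sum_iterPd_mul hΩ S (c := fun c y => α c.1 (jet u y))
          (ψ := fun c => lin u w (pd (uc c.1 c.2) L)) (fun c _ => along (hα c.1))
          (fun c _ => test (hP _)) fun c => c.2
    _ = ∫ y, ∑ a, α a (jet u y) * lin u w (euler a L) y := by
        refine (IsTest.congr_integral (IsTest.sum fun c _ =>
          (((test (hP _)).iterPd c.2).mul_left (IsCkOn.const _)).mul_left (along (hα c.1)))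
          (IsTest.sum fun a _ => (test (hL.euler hU a)).mul_left (along (hα a)))
          fun y hy => ?_).symm
        simp only [hS, Finset.sum_product, ← Finset.mul_sum]
        exact Finset.sum_congr rfl fun a _ => by rw [lin_euler hU hΩ hL hs hu hws hj a hy]

end Duality

/-! ### Vanishing to finite and infinite order on a time slice. -/

section Slice

variable {p : ℕ} {Ω : Set (Fin p → ℝ)} {τ : Fin p} {t₀ : ℝ} {k : ℕ}
  {f g : (Fin p → ℝ) → ℝ}

/-- The derivatives of `g` in `x^τ` of order less than `k` vanish on the slice `x^τ = t₀`
of `Ω`. -/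
def VanishesOnSlice (Ω : Set (Fin p → ℝ)) (τ : Fin p) (t₀ : ℝ) (k : ℕ)
    (g : (Fin p → ℝ) → ℝ) : Prop :=
  ∀ j < k, ∀ y ∈ Ω, y τ = t₀ → (pd τ)^[j] g y = 0

namespace VanishesOnSlice

theorem succ_iff : VanishesOnSlice Ω τ t₀ (k + 1) g ↔
    (∀ y ∈ Ω, y τ = t₀ → g y = 0) ∧ VanishesOnSlice Ω τ t₀ k (pd τ g) := by
  constructor
  · exact fun h => ⟨h 0 (by omega), fun j hj => h (j + 1) (by omega)⟩
  · rintro ⟨h0, h1⟩ (_ | j) hj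
    · exact h0
    · exact h1 j (by omega)

theorem mono {l : ℕ} (h : VanishesOnSlice Ω τ t₀ k g) (hl : l ≤ k) :
    VanishesOnSlice Ω τ t₀ l g := fun j hj => h j (hj.trans_le hl)

theorem congr (hΩ : IsOpen Ω) (h : VanishesOnSlice Ω τ t₀ k g) (he : Set.EqOn f g Ω) :
    VanishesOnSlice Ω τ t₀ k f := by
  intro j hj y hy ht
  have := iterPd_congr hΩ he (Pi.single τ j) hy
  rw [iterOp_single, iterOp_single] at this
  rw [this, h j hj y hy ht]

theorem add (hΩ : IsOpen Ω) (hf : IsCkOn ∞ Ω f) (hg : IsCkOn ∞ Ω g)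
    (h : VanishesOnSlice Ω τ t₀ k f) (h' : VanishesOnSlice Ω τ t₀ k g) :
    VanishesOnSlice Ω τ t₀ k fun y => f y + g y := by
  induction k generalizing f g with
  | zero => intro j hj; omega
  | succ k ih =>
    rw [succ_iff] at h h' ⊢
    refine ⟨fun y hy ht => by rw [h.1 y hy ht, h'.1 y hy ht, add_zero], ?_⟩
    exact (ih (hf.pd (by simp) τ) (hg.pd (by simp) τ) h.2 h'.2).congr hΩ fun y hy =>
      pd_add (hf.differentiableAt (by simp) hy) (hg.differentiableAt (by simp) hy) τ

theorem zero : VanishesOnSlice Ω τ t₀ k fun _ => 0 := by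
  intro j _ y _ _
  have := iterPd_zero_fun (p := p) (Pi.single τ j)
  rw [iterOp_single] at this
  rw [this]

theorem sum (hΩ : IsOpen Ω) {ι : Type*} {s : Finset ι} {f : ι → (Fin p → ℝ) → ℝ}
    (hf : ∀ i ∈ s, IsCkOn ∞ Ω (f i)) (h : ∀ i ∈ s, VanishesOnSlice Ω τ t₀ k (f i)) :
    VanishesOnSlice Ω τ t₀ k fun y => ∑ i ∈ s, f i y := by
  classical
  induction s using Finset.induction_on with
  | empty => simpa using zero
  | insert i s hi ih =>
    simp only [Finset.sum_insert hi]
    exact add hΩ (hf i (by simp)) (IsCkOn.sum fun j hj => hf j (by simp [hj])) (h i (by simp))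
      (ih (fun j hj => hf j (by simp [hj])) fun j hj => h j (by simp [hj]))

theorem mul_left (hΩ : IsOpen Ω) (hf : IsCkOn ∞ Ω f) (hg : IsCkOn ∞ Ω g)
    (h : VanishesOnSlice Ω τ t₀ k g) : VanishesOnSlice Ω τ t₀ k fun y => f y * g y := by
  induction k generalizing f g with
  | zero => intro j hj; omega
  | succ k ih =>
    have hf' := hf.pd (by simp) τ
    have hg' := hg.pd (by simp) τ
    have hk := h.mono (Nat.le_succ k)
    rw [succ_iff] at h ⊢
    refine ⟨fun y hy ht => by rw [h.1 y hy ht, mul_zero], ?_⟩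
    exact (add hΩ (hf'.mul hg) (hf.mul hg') (ih hf' hg hk) (ih hf hg' h.2)).congr hΩ
      fun y hy => pd_mul (hf.differentiableAt (by simp) hy) (hg.differentiableAt (by simp) hy) τ

/-- Directions other than `τ` are tangent to the slice, so these derivatives cost no order of
vanishing. -/
theorem pd_of_ne (hΩ : IsOpen Ω) (hg : IsCkOn ∞ Ω g) {i : Fin p} (hi : i ≠ τ)
    (h : VanishesOnSlice Ω τ t₀ k g) : VanishesOnSlice Ω τ t₀ k (pd i g) := by
  induction k generalizing g with
  | zero => intro j hj; omega
  | succ k ih =>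
    rw [succ_iff] at h ⊢
    refine ⟨fun y hy ht => pd_eq_zero_of_const ?_, ?_⟩
    · filter_upwards [(tendsto_update y i).eventually (hΩ.mem_nhds hy)] with r hr
      rw [h.1 y hy ht, h.1 _ hr (by rwa [Function.update_of_ne hi.symm])]
    · exact (ih (hg.pd (by simp) τ) h.2).congr hΩ fun y hy =>
        pd_comm ((hg y hy).of_le (WithTop.coe_le_coe.2 le_top)) τ i

/-- Only the `J τ` time differentiations lower the order; this count drives both Cauchy–Kovalevskaya
inductions. -/
theorem iterPd (hΩ : IsOpen Ω) (hg : IsCkOn ∞ Ω g) (J : MultiIdx p)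
    (h : VanishesOnSlice Ω τ t₀ (k + J τ) g) : VanishesOnSlice Ω τ t₀ k (iterOp pd J g) := by
  induction J using MultiIdx.induction generalizing k with
  | h0 => simpa using h
  | h1 J i ih =>
    refine VanishesOnSlice.congr hΩ ?_ (pd_iterPd hΩ hg J i).symm
    by_cases hi : i = τ
    · subst hi
      refine (succ_iff.1 (ih (k := k + 1) ?_)).2
      convert h using 1
      simp only [Pi.add_apply, Pi.single_eq_same]
      omega
    · refine pd_of_ne hΩ (hg.iterPd (by simp) J) hi (ih ?_)
      simpa [Pi.single_eq_of_ne (Ne.symm hi)] using h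

end VanishesOnSlice

theorem iterate_deriv_update (g : (Fin p → ℝ) → ℝ) (y : Fin p → ℝ) (τ : Fin p) (k : ℕ) :
    iteratedDeriv k (fun s => g (Function.update y τ s)) =
      fun s => (pd τ)^[k] g (Function.update y τ s) := by
  induction k with
  | zero => simp
  | succ k ih =>
    rw [iteratedDeriv_succ, ih, Function.iterate_succ_apply']
    funext s
    simp [pd]

/-- An analytic function on a connected domain, all of whose normal derivatives vanish on a slice
`x^τ = t₀`, vanishes. -/
theorem eqOn_zero_of_vanishesOnSlice (hΩ : IsOpen Ω) (hc : IsPreconnected Ω)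
    (hg : IsCkOn ω Ω g) {y₀ : Fin p → ℝ} (hy₀ : y₀ ∈ Ω) (ht₀ : y₀ τ = t₀)
    (h : ∀ k, VanishesOnSlice Ω τ t₀ k g) : Set.EqOn g 0 Ω := by
  have hga : AnalyticOnNhd ℝ g Ω := fun y hy => (hg y hy).analyticAt
  refine hga.eqOn_zero_of_preconnected_of_eventuallyEq_zero hc hy₀ ?_
  obtain ⟨r, hr, hball⟩ := Metric.isOpen_iff.1 hΩ y₀ hy₀
  filter_upwards [Metric.ball_mem_nhds y₀ hr] with y hy
  -- Balls of the sup metric are cubes, so the time line through a nearby `y` meets the slice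
  -- without leaving `Ω`.
  have hmem : ∀ s ∈ Metric.ball t₀ r, Function.update y τ s ∈ Ω := by
    intro s hs
    refine hball ?_
    rw [Metric.mem_ball, dist_pi_lt_iff hr] at hy ⊢
    intro j
    by_cases hj : j = τ
    · subst hj; simpa [ht₀] using hs
    · simpa [hj] using hy j
  have ht₀r : t₀ ∈ Metric.ball t₀ r := Metric.mem_ball_self hr
  have han : AnalyticOnNhd ℝ (fun s => g (Function.update y τ s)) (Metric.ball t₀ r) := by
    intro s hs
    have h1 : ContDiffAt ℝ ω (fun s : ℝ => Function.update y τ s) s :=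
      (contDiff_update ω y τ).contDiffAt
    exact (ContDiffAt.comp (g := g) s (hg _ (hmem s hs)) h1).analyticAt
  have hz : (fun s => g (Function.update y τ s)) =ᶠ[𝓝 t₀] 0 := by
    have hord : analyticOrderAt (fun s => g (Function.update y τ s)) t₀ = ⊤ := by
      refine ENat.eq_top_iff_forall_ge.2 fun k => ?_
      rw [natCast_le_analyticOrderAt_iff_iteratedDeriv_eq_zero (han t₀ ht₀r)]
      intro i _
      rw [iterate_deriv_update]
      exact h (i + 1) i (by omega) _ (hmem t₀ ht₀r) (by simp)
    exact analyticOrderAt_eq_top.1 hord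
  have := han.eqOn_zero_of_preconnected_of_eventuallyEq_zero
    (convex_ball t₀ r).isPreconnected ht₀r hz (x := y τ) (by
      rw [Metric.mem_ball, dist_pi_lt_iff hr] at hy
      simpa [ht₀] using hy τ)
  simpa using this

end Slice

/-! ### Linear Cauchy–Kovalevskaya systems and their adjoints: formal uniqueness. -/

section CauchyKovalevskaya

variable {p q : ℕ} {U : Set (Jet p q)} {Ω : Set (Fin p → ℝ)}
  {u w : (Fin p → ℝ) → (Fin q → ℝ)} {τ : Fin p} {n : Fin q → ℕ} {Δ : Fin q → Jet p q → ℝ}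

theorem IsCKForm.isDiffFun (hΔ : IsCKForm U τ n Δ) (a : Fin q) : IsDiffFun ∞ U (Δ a) := by
  obtain ⟨-, Q, hQ, -, hQe⟩ := hΔ
  exact ((IsDiffFun.coord _).sub (hQ a)).congr (hQe a)

/-- The linearization of a system in Cauchy-Kovalevskaya form. -/
theorem IsCKForm.exists_lin (hΔ : IsCKForm U τ n Δ) (hU : IsOpen U) (hj : ∀ y ∈ Ω, jet u y ∈ U)
    (hu : ∀ a, IsCkOn ∞ Ω fun y => u y a) :
    ∃ (s : Finset (MultiIdx p)) (A : Fin q → Fin q → MultiIdx p → (Fin p → ℝ) → ℝ),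
      (∀ a b J, IsCkOn ∞ Ω (A a b J)) ∧ (∀ a b J, n b ≤ J τ → Set.EqOn (A a b J) 0 Ω) ∧
      ∀ (w : (Fin p → ℝ) → (Fin q → ℝ)) (a : Fin q),
        Set.EqOn (lin u w (Δ a)) (fun y => (pd τ)^[n a] (fun x => w x a) y -
          ∑ c ∈ Finset.univ ×ˢ s, A a c.1 c.2 y * iterOp pd c.2 (fun x => w x c.1) y) Ω := by
  classical
  obtain ⟨-, Q, hQ, hQ0, hQe⟩ := hΔ
  choose s hs using fun a => (hQ a).exists_finset hU (by simp)
  refine ⟨Finset.univ.biUnion s, fun a b J y => pd (uc b J) (Q a) (jet u y),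
    fun a b J => ((hQ a).pd hU (by simp) _).along hU (by simp) le_rfl hu hj,
    fun a b J hJ y hy => hQ0 a b J hJ _ (hj y hy), fun w a y hy => ?_⟩
  have hs' : ∀ b, ∀ J ∉ Finset.univ.biUnion s, ∀ z ∈ U, pd (uc b J) (Q a) z = 0 :=
    fun b J hJ => hs a b J fun h => hJ (Finset.mem_biUnion.2 ⟨a, Finset.mem_univ _, h⟩)
  rw [lin_congr hU (hQe a) hj hy, lin_sub hU (IsDiffFun.coord _) (hQ a) (hj y hy), lin_coord,
    iterOp_single, lin_eq_sum hs' hj hy]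
  simp only [mul_comm]

/-- Solutions of the linearized equations with vanishing initial data vanish to infinite order on
the initial slice. -/
theorem vanishesOnSlice_of_lin_eq_zero (hΩ : IsOpen Ω) {t₀ : ℝ} {s : Finset (MultiIdx p)}
    {A : Fin q → Fin q → MultiIdx p → (Fin p → ℝ) → ℝ} (hA : ∀ a b J, IsCkOn ∞ Ω (A a b J))
    (hA0 : ∀ a b J, n b ≤ J τ → Set.EqOn (A a b J) 0 Ω) {g : Fin q → (Fin p → ℝ) → ℝ}
    (hg : ∀ a, IsCkOn ∞ Ω (g a))
    (he : ∀ a, Set.EqOn ((pd τ)^[n a] (g a))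
      (fun y => ∑ c ∈ Finset.univ ×ˢ s, A a c.1 c.2 y * iterOp pd c.2 (g c.1) y) Ω)
    (h0 : ∀ a, VanishesOnSlice Ω τ t₀ (n a) (g a)) (k : ℕ) (a : Fin q) :
    VanishesOnSlice Ω τ t₀ k (g a) := by
  -- The order is shifted by `n a` per component: a term `∂_J g^c` has `J τ < n c`, so order `n c +
  -- k` for `g^c` leaves order `k + 1` for the term.
  suffices h : ∀ k a, VanishesOnSlice Ω τ t₀ (n a + k) (g a) from (h k a).mono (by omega)
  clear k a
  intro k
  induction k with
  | zero => exact h0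
  | succ k ih =>
    intro a j hj
    rcases Nat.lt_succ_iff_lt_or_eq.1 hj with hj | rfl
    · exact ih a j hj
    · have hR : VanishesOnSlice Ω τ t₀ (k + 1) ((pd τ)^[n a] (g a)) := by
        refine VanishesOnSlice.congr hΩ (VanishesOnSlice.sum hΩ (fun c _ =>
          (hA _ _ _).mul ((hg c.1).iterPd (by simp) c.2)) fun c _ => ?_) (he a)
        by_cases hc : n c.1 ≤ c.2 τ
        · exact VanishesOnSlice.zero.congr hΩ fun y hy => by
            simp only [hA0 a c.1 c.2 hc hy, Pi.zero_apply, zero_mul]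
        · refine VanishesOnSlice.mul_left hΩ (hA _ _ _) ((hg c.1).iterPd (by simp) c.2) ?_
          exact VanishesOnSlice.iterPd hΩ (hg c.1) c.2 ((ih c.1).mono (by omega))
      have := hR k (by omega)
      rwa [← Function.iterate_add_apply, add_comm] at this

/-- The same for the adjoint of the linearized equations. -/
theorem vanishesOnSlice_of_adjoint_eq_zero (hΩ : IsOpen Ω) {t₀ : ℝ} {s : Finset (MultiIdx p)}
    {A : Fin q → Fin q → MultiIdx p → (Fin p → ℝ) → ℝ} (hA : ∀ a b J, IsCkOn ∞ Ω (A a b J))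
    (hA0 : ∀ a b J, n b ≤ J τ → Set.EqOn (A a b J) 0 Ω) {g : Fin q → (Fin p → ℝ) → ℝ}
    (hg : ∀ a, IsCkOn ∞ Ω (g a))
    (he : ∀ w : (Fin p → ℝ) → (Fin q → ℝ), (∀ a, IsTest Ω fun y => w y a) →
      ∫ y, ∑ a, g a y * ((pd τ)^[n a] (fun x => w x a) y -
        ∑ c ∈ Finset.univ ×ˢ s, A a c.1 c.2 y * iterOp pd c.2 (fun x => w x c.1) y) = 0)
    (h0 : ∀ a, VanishesOnSlice Ω τ t₀ (n a) (g a)) (k : ℕ) (a : Fin q) :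
    VanishesOnSlice Ω τ t₀ k (g a) := by
  have hB : ∀ a b J, IsCkOn ∞ Ω fun y => g a y * A a b J y := fun a b J => (hg a).mul (hA a b J)
  set R : Fin q → (Fin p → ℝ) → ℝ := fun b y => ∑ d ∈ (Finset.univ : Finset (Fin q)) ×ˢ s,
    (-1) ^ d.2.len * iterOp pd d.2 (fun y => g d.1 y * A d.1 b d.2 y) y with hRdef
  have hRs : ∀ b, IsCkOn ∞ Ω (R b) := fun b => IsCkOn.sum fun d _ =>
    (IsCkOn.const _).mul ((hB _ _ _).iterPd (by simp) _)
  -- The adjoint equations in strong form, solved for `∂_t^{n b} g^b`. Row `b` applies fewer than `n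
  -- b` time derivatives to every component.
  have hevol : ∀ b, Set.EqOn (iterOp pd (Pi.single τ (n b)) (g b))
      (fun y => (-1) ^ (n b) * R b y) Ω := by
    have hlen : ∀ b, MultiIdx.len (Pi.single τ (n b) : MultiIdx p) = n b := fun b => by
      simp [MultiIdx.len]
    have hG := eqOn_zero_of_integral_sum_eq_zero hΩ
      (G := fun b y => (-1) ^ (n b) * iterOp pd (Pi.single τ (n b)) (g b) y + -1 * R b y)
      (fun b => ((IsCkOn.const _).mul ((hg b).iterPd (by simp) _)).add
        ((IsCkOn.const _).mul (hRs b))) fun w hw => ?_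
    · intro b y hy
      have h1 := hG b hy
      have h2 : ((-1 : ℝ) ^ n b) * (-1) ^ n b = 1 := by rw [← mul_pow]; simp
      simp only at h1 ⊢
      linear_combination (-1) ^ n b * h1 - iterOp pd (Pi.single τ (n b)) (g b) y * h2
    · have t1 : IsTest Ω fun y => ∑ b, g b y * iterOp pd (Pi.single τ (n b)) (fun x => w x b) y :=
        IsTest.sum fun b _ => ((hw b).iterPd _).mul_left (hg b)
      set S : Finset (Fin q × (Fin q × MultiIdx p)) := Finset.univ ×ˢ (Finset.univ ×ˢ s) with hS
      have t2 : IsTest Ω fun y => ∑ c ∈ S,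
          g c.1 y * A c.1 c.2.1 c.2.2 y * iterOp pd c.2.2 (fun x => w x c.2.1) y :=
        IsTest.sum fun c _ => ((hw _).iterPd _).mul_left (hB _ _ _)
      have t1' : IsTest Ω fun y => ∑ b, (-1) ^ MultiIdx.len (Pi.single τ (n b)) *
          iterOp pd (Pi.single τ (n b)) (g b) y * w y b :=
        IsTest.sum fun b _ => (hw b).mul_left
          ((IsCkOn.const _).mul ((hg b).iterPd (by simp) _))
      have t2' : IsTest Ω fun y => ∑ c ∈ S, (-1) ^ c.2.2.len *
          iterOp pd c.2.2 (fun y => g c.1 y * A c.1 c.2.1 c.2.2 y) y * w y c.2.1 :=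
        IsTest.sum fun c _ => (hw _).mul_left
          ((IsCkOn.const _).mul ((hB _ _ _).iterPd (by simp) _))
      rw [← he w hw]
      calc _ = ∫ y, ((∑ b, (-1) ^ MultiIdx.len (Pi.single τ (n b)) *
              iterOp pd (Pi.single τ (n b)) (g b) y * w y b) -
            ∑ c ∈ S, (-1) ^ c.2.2.len *
              iterOp pd c.2.2 (fun y => g c.1 y * A c.1 c.2.1 c.2.2 y) y * w y c.2.1) := by
            congr 1
            funext y
            have e : ∑ c ∈ S, (-1) ^ c.2.2.len * iterOp pd c.2.2
                (fun y => g c.1 y * A c.1 c.2.1 c.2.2 y) y * w y c.2.1 =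
                ∑ b, R b y * w y b := by
              simp only [hS, hRdef, Finset.sum_product, Finset.sum_mul]
              exact Finset.sum_comm
            rw [e, ← Finset.sum_sub_distrib]
            refine Finset.sum_congr rfl fun b _ => ?_
            rw [hlen]; ring
        _ = ∫ y, ((∑ b, g b y * iterOp pd (Pi.single τ (n b)) (fun x => w x b) y) -
            ∑ c ∈ S, g c.1 y * A c.1 c.2.1 c.2.2 y *
              iterOp pd c.2.2 (fun x => w x c.2.1) y) := by
            rw [integral_sub t1.integrable t2.integrable, integral_sub t1'.integrable t2'.integrable,
              integral_sum_mul_iterPd hΩ Finset.univ (c := g) (ψ := fun b y => w y b)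
                (fun b _ => hg b) (fun b _ => hw b) fun b => Pi.single τ (n b),
              integral_sum_mul_iterPd hΩ S (c := fun c y => g c.1 y * A c.1 c.2.1 c.2.2 y)
                (ψ := fun c y => w y c.2.1) (fun c _ => hB _ _ _) (fun c _ => hw _)
                fun c => c.2.2]
        _ = _ := by
            congr 1
            funext y
            simp only [hS, Finset.sum_product, iterOp_single, mul_sub, Finset.sum_sub_distrib,
              Finset.mul_sum, mul_assoc]
  -- The restriction `J τ < n b` now depends on the row and not on the component differentiated, so
  -- a common order `k` for all components is the right induction variable.
  induction k generalizing a with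
  | zero => intro j hj; omega
  | succ k ih =>
    intro j hj
    rcases Nat.lt_succ_iff_lt_or_eq.1 hj with hj | rfl
    · exact ih a j hj
    · by_cases hja : j < n a
      · exact h0 a j hja
      -- The derivative of order `n a + i` is the `i`-th time derivative of row `a`, whose terms
      -- need order at most `i + 1 + (n a - 1) = n a + i`: just the induction hypothesis.
      · obtain ⟨i, rfl⟩ := Nat.exists_eq_add_of_le (not_lt.1 hja)
        have hR : VanishesOnSlice Ω τ t₀ (i + 1) ((pd τ)^[n a] (g a)) := by
          have := hevol a
          rw [iterOp_single] at this
          refine VanishesOnSlice.congr hΩ (VanishesOnSlice.mul_left hΩ (IsCkOn.const _) (hRs a)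
            (VanishesOnSlice.sum hΩ (fun d _ => (IsCkOn.const _).mul
              ((hB _ _ _).iterPd (by simp) _)) fun d _ => VanishesOnSlice.mul_left hΩ
              (IsCkOn.const _) ((hB _ _ _).iterPd (by simp) _) ?_)) this
          refine VanishesOnSlice.iterPd hΩ (hB _ _ _) d.2 ?_
          by_cases hd : n a ≤ d.2 τ
          · exact VanishesOnSlice.zero.congr hΩ fun y hy => by
              simp only [hA0 d.1 a d.2 hd hy, Pi.zero_apply, mul_zero]
          · exact ((VanishesOnSlice.mul_left hΩ (hA _ _ _) (hg _) (ih d.1)).mono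
              (by omega)).congr hΩ fun y _ => mul_comm _ _
        have := hR i (by omega)
        rwa [← Function.iterate_add_apply, add_comm] at this

end CauchyKovalevskaya

/-! ### Transfer from `α` to `T* α`, and reduction of compatibility to vanishing on the slice. -/

section Duality

variable {p q : ℕ} {U : Set (Jet p q)} {Ω : Set (Fin p → ℝ)}
  {u w : (Fin p → ℝ) → (Fin q → ℝ)} {α Δ : Fin q → Jet p q → ℝ}

/-- On solutions of `Δ = 0`, the pairing of `α` with the linearization of `T Δ` is that of `T* α`
with the linearization of `Δ`. -/
theorem integral_adj_mul_lin (hU : IsOpen U) (hΩ : IsOpen Ω) {T : DiffOp p q}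
    (hT : T.IsClass ∞ U) (hα : ∀ a, IsDiffFun ∞ U (α a)) (hΔ : ∀ a, IsDiffFun ∞ U (Δ a))
    (hu : ∀ a, IsCkOn ∞ Ω fun y => u y a) (hw : ∀ a, IsTest Ω fun y => w y a)
    (hj : ∀ y ∈ Ω, jet u y ∈ U) (h0 : ∀ a, ∀ y ∈ Ω, Δ a (jet u y) = 0) :
    ∫ y, ∑ b, T.adj α b (jet u y) * lin u w (Δ b) y =
      ∫ y, ∑ a, α a (jet u y) * lin u w (T.app Δ a) y := by
  obtain ⟨s, hs, hs'⟩ := T.exists_finset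
  have along : ∀ {f}, IsDiffFun ∞ U f → IsCkOn ∞ Ω fun y => f (jet u y) := fun hf =>
    hf.along hU (by simp) le_rfl hu hj
  have test : ∀ {f}, IsDiffFun ∞ U f → IsTest Ω (lin u w f) := fun hf =>
    isTest_lin hU hΩ hf hu hw hj
  have hTα : ∀ a b J, IsDiffFun ∞ U fun z => T a b J z * α a z := fun a b J =>
    (hT a b J).mul (hα a)
  set S : Finset (Fin q × (Fin q × MultiIdx p)) := Finset.univ ×ˢ (Finset.univ ×ˢ s) with hS
  calc ∫ y, ∑ b, T.adj α b (jet u y) * lin u w (Δ b) y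
      = ∫ y, ∑ c ∈ S, (-1) ^ c.2.2.len *
          iterOp pd c.2.2 (fun y => T c.1 c.2.1 c.2.2 (jet u y) * α c.1 (jet u y)) y *
            lin u w (Δ c.2.1) y := by
        refine IsTest.congr_integral (IsTest.sum fun c _ => (test (hΔ _)).mul_left
          ((IsCkOn.const _).mul ((along (hTα _ _ _)).iterPd (by simp) _)))
          (IsTest.sum fun b _ => (test (hΔ b)).mul_left
            (along (hT.adj hU (by simp) hα b))) fun y hy => ?_
        simp only [hs', hS, Finset.sum_product, Finset.sum_mul]
        rw [Finset.sum_comm]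
        refine Finset.sum_congr rfl fun a _ => Finset.sum_congr rfl fun b _ =>
          Finset.sum_congr rfl fun J _ => ?_
        rw [← iterPd_along hU hΩ (hTα a b J) hu hj J hy]
    _ = ∫ y, ∑ c ∈ S, T c.1 c.2.1 c.2.2 (jet u y) * α c.1 (jet u y) *
          iterOp pd c.2.2 (lin u w (Δ c.2.1)) y :=
        (integral_sum_mul_iterPd hΩ S
          (c := fun c y => T c.1 c.2.1 c.2.2 (jet u y) * α c.1 (jet u y))
          (ψ := fun c => lin u w (Δ c.2.1)) (fun c _ => along (hTα _ _ _))
          (fun c _ => test (hΔ _)) fun c => c.2.2).symm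
    _ = ∫ y, ∑ a, α a (jet u y) * lin u w (T.app Δ a) y := by
        refine (IsTest.congr_integral (IsTest.sum fun c _ =>
          ((test (hΔ _)).iterPd _).mul_left (along (hTα _ _ _)))
          (IsTest.sum fun a _ => (test (hT.app hU (by simp) hΔ a)).mul_left (along (hα a)))
          fun y hy => ?_).symm
        simp only [hS, Finset.sum_product]
        refine Finset.sum_congr rfl fun a _ => ?_
        rw [lin_app hU hΩ hT (hs Δ) hΔ hu (fun a => (hw a).1) hj h0 a hy, Finset.mul_sum,
          Finset.sum_product]
        exact Finset.sum_congr rfl fun b _ => Finset.sum_congr rfl fun J _ => by ring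

/-- Compatibility follows once the solutions of `S = 0` which satisfy the initial condition are
shown to satisfy it to infinite order. -/
theorem isCompatible_of_vanishesOnSlice {τ : Fin p} {n : Fin q → ℕ} {S γ : Fin q → Jet p q → ℝ}
    (hU : IsOpen U) (hγ : ∀ a, IsDiffFun ω U (γ a))
    (h : ∀ (Ω : Set (Fin p → ℝ)) (u : (Fin p → ℝ) → (Fin q → ℝ)) (t₀ : ℝ), IsOpen Ω →
      (∀ a, IsCkOn ∞ Ω fun y => u y a) → (∀ y ∈ Ω, jet u y ∈ U) →
      (∀ a, ∀ y ∈ Ω, S a (jet u y) = 0) →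
      (∀ a, VanishesOnSlice Ω τ t₀ (n a) fun y => γ a (jet u y)) →
      ∀ k a, VanishesOnSlice Ω τ t₀ k fun y => γ a (jet u y)) :
    IsCompatible U τ n S γ := by
  rintro Ω u t₀ hΩ hc ⟨y₀, hy₀, ht₀⟩ hu hj hS h0 y hy a
  have hu' : ∀ a, IsCkOn ω Ω fun y => u y a := fun a y hy =>
    contDiffAt_pi.1 (hu y hy).contDiffAt a
  have hu'' : ∀ a, IsCkOn ∞ Ω fun y => u y a := fun a => (hu' a).of_le le_top
  -- Analyticity and connectedness enter only here; the hypothesis `h` is purely smooth.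
  refine eqOn_zero_of_vanishesOnSlice hΩ hc ((hγ a).along hU (by simp) le_top hu' hj) hy₀ ht₀
    (fun k => h Ω u t₀ hΩ hu'' hj (fun a y hy => hS y hy a) (fun a k hk y hy ht => ?_) k a) hy
  rw [← iterate_pd_along hU hΩ ((hγ a).of_le le_top) hu'' hj τ k hy]
  exact h0 y hy ht a k hk

end Duality

end JetCalculus

/-! ### The duality of compatible systems. -/

open JetCalculus in
theorem mainTheorem4 {p q : ℕ} (τ : Fin p) (U : Set (JetCalculus.Jet p q)) (hU : IsOpen U)
    (n : Fin q → ℕ)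
    (Δ : Fin q → JetCalculus.Jet p q → ℝ) (hΔ : JetCalculus.IsCKForm U τ n Δ)
    (L : JetCalculus.Jet p q → ℝ) (hL : JetCalculus.IsDiffFun ∞ U L)
    (T : JetCalculus.DiffOp p q) (hT : T.IsClass ω U)
    (α : Fin q → JetCalculus.Jet p q → ℝ) (hα : ∀ a, JetCalculus.IsDiffFun ω U (α a))
    (hE : ∀ a, ∀ z ∈ U, JetCalculus.euler a L z = T.app Δ a z)
    (hX : JetCalculus.IsDivergence U (JetCalculus.evol α L)) :
    JetCalculus.IsCompatible U τ n Δ (T.adj α) ∧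
      ∀ m : Fin q → ℕ, JetCalculus.HasCKForm U τ m (T.app Δ) →
        JetCalculus.IsCompatible U τ m (T.app Δ) α := by
  have hT' : T.IsClass ∞ U := fun a b J => (hT a b J).of_le le_top
  have hα' : ∀ a, IsDiffFun ∞ U (α a) := fun a => (hα a).of_le le_top
  have hΔ' : ∀ a, IsDiffFun ∞ U (Δ a) := hΔ.isDiffFun
  have hF : ∀ a, IsDiffFun ∞ U (T.app Δ a) := hT'.app hU (by simp) hΔ'
  refine ⟨isCompatible_of_vanishesOnSlice hU (hT.adj hU (by simp) hα) ?_, fun m hm =>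
    isCompatible_of_vanishesOnSlice hU hα ?_⟩
  · intro Ω u t₀ hΩ hu hj hS h0
    have hγ : ∀ a, IsCkOn ∞ Ω fun y => T.adj α a (jet u y) := fun a =>
      (hT'.adj hU (by simp) hα' a).along hU (by simp) le_rfl hu hj
    have hE0 : ∀ a, ∀ y ∈ Ω, euler a L (jet u y) = 0 := fun a y hy => by
      rw [hE a _ (hj y hy), app_along_eq_zero hU hΩ T hΔ' hu hj hS a y hy]
    obtain ⟨s, A, hA, hA0, hlin⟩ := hΔ.exists_lin hU hj hu
    -- It remains to show that `T* α` is orthogonal to the linearization of `Δ`; this pairing equals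
    -- that of `α` with the linearization of `T Δ = E(L)`.
    refine vanishesOnSlice_of_adjoint_eq_zero (s := s) hΩ hA hA0 hγ (fun w hw => ?_) h0
    have h1 := integral_mul_lin_euler_eq_zero hU hΩ hL hα' hX hu hw hj hE0
    have h2 := integral_adj_mul_lin hU hΩ hT' hα' hΔ' hu hw hj hS
    rw [← h1]
    refine Eq.trans ?_ (h2.trans ?_)
    · refine IsTest.congr_integral (IsTest.sum fun a _ =>
        (isTest_lin hU hΩ (hΔ' a) hu hw hj).mul_left (hγ a)) (IsTest.sum fun a _ =>
          IsTest.mul_left ?_ (hγ a)) fun y hy => ?_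
      · have t1 : IsTest Ω ((pd τ)^[n a] fun x => w x a) := by
          rw [← iterOp_single]; exact (hw a).iterPd _
        have t2 : IsTest Ω fun y => ∑ c ∈ Finset.univ ×ˢ s,
            A a c.1 c.2 y * iterOp pd c.2 (fun x => w x c.1) y :=
          IsTest.sum fun c _ => ((hw _).iterPd _).mul_left (hA _ _ _)
        simpa [sub_eq_add_neg] using t1.add (t2.mul_left (IsCkOn.const (-1)))
      · exact Finset.sum_congr rfl fun a _ => by rw [hlin w a hy]
    · refine IsTest.congr_integral (IsTest.sum fun a _ =>
        (isTest_lin hU hΩ (hL.euler hU a) hu hw hj).mul_left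
          ((hα' a).along hU (by simp) le_rfl hu hj))
        (IsTest.sum fun a _ => (isTest_lin hU hΩ (hF a) hu hw hj).mul_left
          ((hα' a).along hU (by simp) le_rfl hu hj)) fun y hy => ?_
      exact Finset.sum_congr rfl fun a _ => by rw [lin_congr hU (hE a) hj hy]
  · intro Ω u t₀ hΩ hu hj hS h0
    obtain ⟨B, hB, hBS⟩ := hm
    have hw : ∀ a, IsCkOn ∞ Ω fun y => α a (jet u y) := fun a =>
      (hα' a).along hU (by simp) le_rfl hu hj
    have hl : ∀ a, ∀ y ∈ Ω, lin u (fun y a => α a (jet u y)) (T.app Δ a) y = 0 := fun a y hy => by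
      rw [← lin_congr hU (hE a) hj hy]
      exact lin_euler_symmetry_eq_zero hU hΩ hL hα' hX hu hj
        (fun a y hy => by rw [hE a _ (hj y hy), hS a y hy]) a y hy
    -- Since `T Δ = 0` along `u`, the kernel property survives applying `B`, whose result is in
    -- Cauchy–Kovalevskaya form.
    have hlB := lin_app_eq_zero hU hΩ hB hF hu hw hj hS hl
    obtain ⟨s, A, hA, hA0, hlin⟩ := hBS.exists_lin hU hj hu
    refine vanishesOnSlice_of_lin_eq_zero (s := s) hΩ hA hA0 hw (fun a y hy => ?_) h0
    have := hlin (fun y a => α a (jet u y)) a hy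
    rw [hlB a y hy] at this
    exact (sub_eq_zero.1 this.symm)
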